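/- **Setting.** Let $X$ be a real Banach space with dual $X^*$, and write $\langle f,\varphi\rangle$ for the value of $f\in X^*$ at $\varphi\in X$. Let $M:X\to X^*$ be an acceleration operator, i.e. a bounded invertible linear operator that is Hermitian ($\langle M\varphi,\psi\rangle=\langle M\psi,\varphi\rangle$) and positive definite ($\langle M\varphi,\varphi\rangle>0$ for $\varphi\neq0$). (For a positive-definite self-adjoint operator $M$ in $L^2(\mathbb R^N;\mathbb R^K)$, $X$ is the energy space of $M$, and $\langle\cdot,\cdot\rangle$ extends the $L^2$ inner product; for a spatially discretized problem, $X=\mathbb R^d$.) Let $r\ge1$, $s\ge 0$, and consider $$L_0u\equiv L_{00}u-B(u)\vec\mu=0,\qquad Q_j(u)=C_j\quad(j=1,\dots,r),$$ with unknown $u\in X$ and $\vec\mu\in\mathbb R^r$, where $L_{00}:X\to X^*$, $B(u)=(B_1(u),\dots,B_r(u))$ with $B_j:X\to X^*$, $Q_j:X\to\mathbb R$ and $C_j\in\mathbb R$. Let $U(\vec\mu;c)\in X$, $c=(c_1,\dots,c_s)\in\mathbb R^s$, be a $C^1$ family of solutions of $L_0u=0$ defined for $(\vec\mu,c)$ near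 $(\vec\mu_0,c_0)$; let the solitary wave $u=U(\vec\mu_0;c_0)$ satisfy $Q_j(u)=C_j$ for all $j$, and let $L_{00}$, $B_j$, $Q_j$ be $C^2$ near $u$. Let $L_1$ be the derivative of $L_0$ at fixed $\vec\mu$ (taken at $(\vec\mu_0,u)$ unless said otherwise), $L_1^\dagger$ its adjoint, and $\delta Q_j/\delta u\in X^*$ the derivative of $Q_j$. For $h>0$ and a time step $\Delta t$, the quantity-conserving squared-operator method (QCSOM) is the iteration $$u_{n+1}=u_n-M^{-1}\Big[L_1^\dagger M^{-1}L_0u+h\sum_{j=1}^r(Q_j(u)-C_j)\frac{\delta Q_j}{\delta u}\Big]_{u=u_n,\ \vec\mu=\vec\mu_n}\Delta t,\qquad \vec\mu_n=\langle B,M^{-1}B\rangle^{-1}\langle B,M^{-1}L_{00}u\rangle\big|_{u=u_n},$$ where $L_1^\dagger$ is also taken at $u_n$, $\vec\mu_n$. Define the bounded operator $\mathcal L_{QC}$ on $X$, at the solitary wave $u$, $\vec\mu_0$, by $$\mathcal L_{QC}\Psi=M^{-1}\Big(-L_1^\dagger M^{-1}\big(L_1\Psi-B\langle B,M^{-1}B\rangle^{-1}\langle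 B,M^{-1}L_1\Psi\rangle\big)-h\sum_{j=1}^r\Big\langle\frac{\delta Q_j}{\delta u},\Psi\Big\rangle\frac{\delta Q_j}{\delta u}\Big).$$ **Theorem.** Assume that * the kernel of $L_1$ is spanned by the invariance modes $\partial U/\partial c_k$, $1\le k\le s$, at $(\vec\mu_0,c_0)$ (Assumption 1); * each $\delta Q_j/\delta u$ at $u$ is orthogonal to $\ker L_1$, i.e. $\langle\delta Q_j/\delta u,\psi\rangle=0$ for all $\psi\in\ker L_1$; * $\det\big(\partial Q_i(U)/\partial\mu_j\big)\ne0$ at $(\vec\mu_0,c_0)$. Then the spectrum of $\mathcal L_{QC}$ has a least element $\Lambda_{\min}$, and $\Lambda_{\min}<0$. Put $\Delta t_{\max}=-2/\Lambda_{\min}$. 1. Let $0<\Delta t<\Delta t_{\max}$. Then every solution of the linearized error iteration $\tilde u_{n+1}=(1+\Delta t\,\mathcal L_{QC})\tilde u_n$ converges to an element of $\ker L_1$. If, moreover, $0$ is not an accumulation point of the spectrum of $\mathcal L_{QC}$ (the nonzero part of the spectrum is bounded above by some $\Lambda_{\max}<0$), then QCSOM converges to the solitary wave, up to its invariances, whenever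 the initial condition is close to $u$: for every $\varepsilon>0$ there is $\delta>0$ such that for every $u_0$ with $\|u_0-u\|<\delta$ the iterates converge in $X$ to a member $U(\vec\mu;c)$ of the solution family with $\|(\vec\mu,c)-(\vec\mu_0,c_0)\|<\varepsilon$ which solves $L_{00}U-B(U)\vec\mu=0$ and satisfies $Q_j(U)=C_j$ for all $j$. 2. Let $\Delta t>\Delta t_{\max}$. Then QCSOM diverges from $u$: there is $\varepsilon>0$ such that arbitrarily close to $u$ there are initial conditions $u_0$ with $\|u_n-u\|\ge\varepsilon$ for some $n$. If, moreover, $\Lambda_{\min}$ is an isolated point of the spectrum, then for some $\varepsilon>0$ the set of initial conditions whose iterates all satisfy $\|u_n-u\|<\varepsilon$ has empty interior. -/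

import Mathlib

open Filter Topology Matrix

noncomputable section

/-!
Setting. `X` is the real Banach space in which the iteration runs and `StrongDual ℝ X` is its dual.
The evaluation `f φ` of `f : StrongDual ℝ X` at `φ : X` is the inner product `⟨f, φ⟩`.

The typical case: waves with values in `ℝ^K` on `ℝ^N`, and `M` a positive-definite self-adjoint
operator in `L²(ℝ^N; ℝ^K)`. Then `X` is the energy space of `M` (its form domain, with inner product
`⟨M φ, ψ⟩`), its dual contains `L²`, the evaluation extends the `L²` inner product, and `M` is an
isomorphism of `X` onto its dual. For `M = c - ∂ₓₓ` this is `H¹` with dual `H⁻¹`. A spatially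
discretized problem is the case `X = ℝ^d` with `M` a symmetric positive-definite matrix.
-/

namespace SolitaryWave

variable {X : Type*} [NormedAddCommGroup X] [NormedSpace ℝ X]

/-- An acceleration operator: an invertible, Hermitian and positive-definite operator. -/
structure AccelerationOperator (X : Type*) [NormedAddCommGroup X] [NormedSpace ℝ X] where
  /-- The operator `M`, as an isomorphism onto the dual. -/
  op : X ≃L[ℝ] StrongDual ℝ X
  hermitian : ∀ φ ψ : X, op φ ψ = op ψ φ
  posDef : ∀ φ : X, φ ≠ 0 → 0 < op φ φ

/-- The inverse `M⁻¹` of the acceleration operator. -/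
def AccelerationOperator.inv (M : AccelerationOperator X) : StrongDual ℝ X →L[ℝ] X :=
  (M.op.symm : StrongDual ℝ X →L[ℝ] X)

/-- The data of a wave equation `L₀₀ u - B(u) μ = 0` with `r` propagation constants
`μ = (μ₁, …, μᵣ)`, together with `r` functionals `Q₁, …, Qᵣ` and prescribed values `C₁, …, Cᵣ`. -/
structure ConstrainedEquation (X : Type*) [NormedAddCommGroup X] [NormedSpace ℝ X] (r : ℕ) where
  /-- The nonlinear operator `L₀₀`. -/
  L00 : X → StrongDual ℝ X
  /-- `B j u` is the `j`-th column of the matrix function `B(u)`. -/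
  B : Fin r → X → StrongDual ℝ X
  /-- The functionals `Qⱼ`. -/
  Q : Fin r → X → ℝ
  /-- The prescribed values `Cⱼ`. -/
  C : Fin r → ℝ

namespace ConstrainedEquation

variable {r : ℕ} (E : ConstrainedEquation X r) (M : AccelerationOperator X)

/-- `L₀ u = L₀₀ u - B(u) μ`. -/
def L0 (μ : Fin r → ℝ) (u : X) : StrongDual ℝ X :=
  E.L00 u - ∑ j, μ j • E.B j u

/-- The linearization `L₁` of `L₀` around `u`, with the propagation constants held fixed. -/
def L1 (μ : Fin r → ℝ) (u : X) : X →L[ℝ] StrongDual ℝ X :=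
  fderiv ℝ (E.L0 μ) u

/-- The Hermitian adjoint `L₁†`: `⟨L₁† φ, ψ⟩ = ⟨L₁ ψ, φ⟩`. -/
def L1adj (μ : Fin r → ℝ) (u : X) : X →L[ℝ] StrongDual ℝ X :=
  (E.L1 μ u).flip

/-- The functional derivative `δQⱼ/δu`. -/
def dQ (j : Fin r) (u : X) : StrongDual ℝ X :=
  fderiv ℝ (E.Q j) u

/-- The `r × r` matrix `⟨B, M⁻¹ B⟩` at `u`. -/
def gram (u : X) : Matrix (Fin r) (Fin r) ℝ :=
  Matrix.of fun i j => E.B i u (M.inv (E.B j u))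

/-- The vector `⟨B, M⁻¹ B⟩⁻¹ ⟨B, M⁻¹ f⟩` at `u`. -/
def coeff (u : X) (f : StrongDual ℝ X) : Fin r → ℝ :=
  (E.gram M u)⁻¹ *ᵥ fun i => E.B i u (M.inv f)

/-- The propagation constants assigned to an iterate:
`μ(u) = ⟨B, M⁻¹ B⟩⁻¹ ⟨B, M⁻¹ L₀₀ u⟩`. -/
def mu (u : X) : Fin r → ℝ :=
  E.coeff M u (E.L00 u)

/-- One step of the quantity-conserving squared-operator method:
`u ↦ u - M⁻¹ [L₁† M⁻¹ L₀ u + h ∑ⱼ (Qⱼ(u) - Cⱼ) δQⱼ/δu] Δt`, where `L₀` and `L₁` are taken at the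
propagation constants `μ(u)` and `L₁` is the linearization around the current iterate `u`. -/
def step (h dt : ℝ) (u : X) : X :=
  u - dt • M.inv (E.L1adj (E.mu M u) u (M.inv (E.L0 (E.mu M u) u)) +
    h • ∑ j, (E.Q j u - E.C j) • E.dQ j u)

/-- The bounded operator `f ↦ B ⟨B, M⁻¹ B⟩⁻¹ ⟨B, M⁻¹ f⟩`. -/
def projB (u : X) : StrongDual ℝ X →L[ℝ] StrongDual ℝ X :=
  ∑ i, ∑ j, (E.gram M u)⁻¹ i j • ((E.B j u).comp M.inv).smulRight (E.B i u)

theorem projB_apply (u : X) (f : StrongDual ℝ X) :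
    E.projB M u f = ∑ i, E.coeff M u f i • E.B i u := by
  ext φ
  simp [projB, coeff, Matrix.mulVec, dotProduct, Finset.sum_mul, mul_assoc]

/-- `L̂ Ψ = - L₁† M⁻¹ (L₁ Ψ - B ⟨B, M⁻¹ B⟩⁻¹ ⟨B, M⁻¹ L₁ Ψ⟩)`. -/
def LPCG (μ : Fin r → ℝ) (u : X) : X →L[ℝ] StrongDual ℝ X :=
  -((E.L1adj μ u).comp (M.inv.comp (E.L1 μ u - (E.projB M u).comp (E.L1 μ u))))

/-- `𝓛_QC Ψ = M⁻¹ (L̂ Ψ - h ∑ⱼ ⟨δQⱼ/δu, Ψ⟩ δQⱼ/δu)`. -/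
def LQC (h : ℝ) (μ : Fin r → ℝ) (u : X) : X →L[ℝ] X :=
  M.inv.comp (E.LPCG M μ u - h • ∑ j, (E.dQ j u).smulRight (E.dQ j u))

theorem LQC_apply (h : ℝ) (μ : Fin r → ℝ) (u ψ : X) :
    E.LQC M h μ u ψ =
      M.inv (-(E.L1adj μ u (M.inv (E.L1 μ u ψ - ∑ i, E.coeff M u (E.L1 μ u ψ) i • E.B i u))) -
        h • ∑ j, (E.dQ j u ψ) • E.dQ j u) := by
  simp [LQC, LPCG, projB_apply]

/-- `U(μ; c)` is near `(μ₀, c₀)` a continuously differentiable family of solutions of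
`L₀₀ u - B(u) μ = 0`, with free parameters `c = (c₁, …, cₛ)`. -/
def IsSolutionFamily {s : ℕ} (U : (Fin r → ℝ) × (Fin s → ℝ) → X)
    (μ₀ : Fin r → ℝ) (c₀ : Fin s → ℝ) : Prop :=
  ContDiffAt ℝ 1 U (μ₀, c₀) ∧ ∀ᶠ p in 𝓝 (μ₀, c₀), E.L0 p.1 (U p) = 0

/-- The kernel of `L₁` at the solution `U(μ₀; c₀)` consists of the invariance modes
`∂U/∂c₁, …, ∂U/∂cₛ` and their linear combinations only. -/
def KernelIsInvarianceModes {s : ℕ} (U : (Fin r → ℝ) × (Fin s → ℝ) → X)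
    (μ₀ : Fin r → ℝ) (c₀ : Fin s → ℝ) : Prop :=
  (E.L1 μ₀ (U (μ₀, c₀))).ker =
    Submodule.span ℝ (Set.range fun k : Fin s => fderiv ℝ U (μ₀, c₀) (0, Pi.single k 1))

/-- The matrix `(∂Qᵢ/∂μⱼ)` along the solution family, at `(μ₀, c₀)`. -/
def dQdmu {s : ℕ} (U : (Fin r → ℝ) × (Fin s → ℝ) → X)
    (μ₀ : Fin r → ℝ) (c₀ : Fin s → ℝ) : Matrix (Fin r) (Fin r) ℝ :=
  Matrix.of fun i j => fderiv ℝ (fun p => E.Q i (U p)) (μ₀, c₀) (Pi.single j 1, 0)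

/-- Local convergence: iterates that start close enough to `U(μ₀; c₀)` converge to a member
`U(μ; c)` of the solution family, with `(μ, c)` as close to `(μ₀, c₀)` as desired, which solves the
equation and satisfies all constraints. -/
def ConvergesNear {s : ℕ} (h dt : ℝ) (U : (Fin r → ℝ) × (Fin s → ℝ) → X)
    (μ₀ : Fin r → ℝ) (c₀ : Fin s → ℝ) : Prop :=
  ∀ ε > 0, ∃ δ > 0, ∀ u₀ : X, ‖u₀ - U (μ₀, c₀)‖ < δ →
    ∃ p : (Fin r → ℝ) × (Fin s → ℝ), ‖p - (μ₀, c₀)‖ < ε ∧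
      E.L0 p.1 (U p) = 0 ∧ (∀ j, E.Q j (U p) = E.C j) ∧
      Tendsto (fun n : ℕ => (E.step M h dt)^[n] u₀) atTop (𝓝 (U p))

/-- Divergence: some fixed neighbourhood of `u` is left by iterates that start arbitrarily close
to `u`. -/
def DivergesFrom (h dt : ℝ) (u : X) : Prop :=
  ∃ ε > 0, ∀ δ > 0, ∃ u₀ : X, ‖u₀ - u‖ < δ ∧ ∃ n : ℕ, ε ≤ ‖(E.step M h dt)^[n] u₀ - u‖

/-- Generic divergence: the initial conditions whose iterates all stay in some fixed neighbourhood
of `u` form a set with empty interior. -/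
def DivergesGenericallyFrom (h dt : ℝ) (u : X) : Prop :=
  ∃ ε > 0, interior {u₀ : X | ∀ n : ℕ, ‖(E.step M h dt)^[n] u₀ - u‖ < ε} = ∅

end ConstrainedEquation

end SolitaryWave

end

/-! In the inner product `⟨M φ, ψ⟩`, whose norm is equivalent to that of `X`, the operator `f ↦ f -
B ⟨B, M⁻¹ B⟩⁻¹ ⟨B, M⁻¹ f⟩` is an orthogonal projection on the dual side. Hence `-𝓛_QC` is symmetric
and its quadratic form is the squared size of the projected residual `L₁ Ψ` plus `h ∑ ⟨δQⱼ/δu, Ψ⟩²`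
(`op_LQC_apply`). So `𝓛_QC ≤ 0`, and its spectrum has a least element (`exists_isLeast_spectrum`). A
null vector satisfies `L₁ Ψ = ∑ aⱼ Bⱼ` and `⟨δQⱼ/δu, Ψ⟩ = 0`. Since `L₁ ∂U/∂μⱼ = Bⱼ`, it differs
from `∑ aⱼ ∂U/∂μⱼ` by an element of `ker L₁`, and the determinant condition forces `a = 0`. Thus
`ker 𝓛_QC = ker L₁` (`ker_LQC`).

The residual with adapted `μ` is the projection of `L₀ u` for any fixed `μ`. The step is therefore a
sum of terms (operator) × (factor vanishing at `u`). This makes `1 + Δt 𝓛_QC` its derivative at `u`,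
with a quadratic remainder although the step is only `C¹` (`isBigO_step_sub`).

Convergence: for `Δt < Δt_max` the powers of `1 + Δt 𝓛_QC` converge strongly to the projection onto
the kernel. With a spectral gap at `0` the derivative contracts the complement of the kernel. The
family restricted to `Q = C` consists of fixed points, and every nearby point lies orthogonally over
one of them (`eventually_exists_solution_below`). Displacements `F x - x` then shrink geometrically
(`tendsto_iterate_of_normally_contracting`).

Divergence: for `Δt > Δt_max` the derivative has norm above `1`, attained multiplicatively along
powers `2 ^ k` by self-adjointness, and the quadratic remainder lets a nonlinear orbit follow the
growing linear one (`exists_escaping_orbit`). If `Λ_min` is isolated, it is an eigenvalue with a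
dominant eigenspace. A cone argument then separates any two trapped points that differ along it
(`exists_interior_trapped_eq_empty`). -/

namespace SolitaryWave

/-! ### Bounded symmetric operators on a real Hilbert space -/

section Spectral

variable {H : Type*} [NormedAddCommGroup H] [InnerProductSpace ℝ H]

local notation "⟪" x ", " y "⟫" => inner ℝ x y

/-- Cauchy–Schwarz for the semi-inner product defined by `T`: the quadratic polynomial `t ↦ ⟪T (x +
t y), x + t y⟫` has no sign change, so its discriminant is nonpositive. -/
theorem inner_sq_le_of_nonneg {T : H →L[ℝ] H} (hT : ∀ x y, ⟪T x, y⟫ = ⟪x, T y⟫)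
    (h0 : ∀ x, 0 ≤ ⟪T x, x⟫) (x y : H) : ⟪T x, y⟫ ^ 2 ≤ ⟪T x, x⟫ * ⟪T y, y⟫ := by
  have key : ∀ t : ℝ, 0 ≤ ⟪T y, y⟫ * (t * t) + 2 * ⟪T x, y⟫ * t + ⟪T x, x⟫ := fun t => by
    have h1 := h0 (x + t • y)
    have h2 : ⟪T y, x⟫ = ⟪T x, y⟫ := by rw [hT, real_inner_comm]
    simp only [map_add, map_smul, inner_add_left, inner_add_right, inner_smul_left,
      inner_smul_right, h2, RCLike.conj_to_real] at h1
    linarith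
  have := discrim_le_zero key
  rw [discrim] at this
  nlinarith

/-- Operator form: `0 ≤ T ≤ c` gives `T² ≤ c T`. Cauchy–Schwarz for `T` is applied to the pair `x`,
`T x`. -/
theorem norm_sq_le_of_inner_le {T : H →L[ℝ] H} (hT : ∀ x y, ⟪T x, y⟫ = ⟪x, T y⟫)
    (h0 : ∀ x, 0 ≤ ⟪T x, x⟫) {c : ℝ} (hc : ∀ x, ⟪T x, x⟫ ≤ c * ‖x‖ ^ 2) (x : H) :
    ‖T x‖ ^ 2 ≤ c * ⟪T x, x⟫ := by
  rcases eq_or_ne (T x) 0 with h | h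
  · simp [h]
  have h1 := inner_sq_le_of_nonneg hT h0 x (T x)
  rw [real_inner_self_eq_norm_sq] at h1
  have h2 := hc (T x)
  have h3 : 0 < ‖T x‖ ^ 2 := by positivity
  have h4 := mul_le_mul_of_nonneg_left h2 (h0 x)
  refine le_of_mul_le_mul_right ?_ h3
  nlinarith

theorem inner_apply_le_opNorm (T : H →L[ℝ] H) (x : H) : |⟪T x, x⟫| ≤ ‖T‖ * ‖x‖ ^ 2 :=
  (abs_real_inner_le_norm _ _).trans (by nlinarith [T.le_opNorm x, norm_nonneg x])

theorem isUnit_of_coercive [CompleteSpace H] {T : H →L[ℝ] H} {c : ℝ} (hc : 0 < c)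
    (h : ∀ x, c * ‖x‖ ^ 2 ≤ ⟪T x, x⟫) : IsUnit T :=
  ContinuousLinearMap.isUnit_of_forall_le_norm_inner_map T (c := ⟨c, hc.le⟩) hc fun x => by
    have := h x
    rw [mul_comm]
    exact this.trans (le_abs_self _)

theorem le_of_mem_spectrum [CompleteSpace H] {T : H →L[ℝ] H} {c : ℝ}
    (h : ∀ x, c * ‖x‖ ^ 2 ≤ ⟪T x, x⟫) {t : ℝ} (ht : t ∈ spectrum ℝ T) : c ≤ t := by
  by_contra! hlt
  rw [spectrum.mem_iff, IsUnit.sub_iff] at ht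
  refine ht (isUnit_of_coercive (sub_pos.2 hlt) fun x => ?_)
  have := h x
  simp only [Algebra.algebraMap_eq_smul_one, _root_.sub_apply,
    _root_.smul_apply, one_apply_eq_self, inner_sub_left,
    inner_smul_left, RCLike.conj_to_real, real_inner_self_eq_norm_sq]
  linarith

/-- The spectrum of a bounded symmetric operator has a least element, the minimum of the
numerical range's closure. -/
theorem exists_isLeast_spectrum [CompleteSpace H] [Nontrivial H] {T : H →L[ℝ] H}
    (hT : ∀ x y, ⟪T x, y⟫ = ⟪x, T y⟫) :
    ∃ m, IsLeast (spectrum ℝ T) m ∧ ∀ x, m * ‖x‖ ^ 2 ≤ ⟪T x, x⟫ := by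
  set s : Set ℝ := {c | ∀ x, c * ‖x‖ ^ 2 ≤ ⟪T x, x⟫}
  have hne : s.Nonempty := ⟨-‖T‖, fun x => by
    have := (abs_le.1 (inner_apply_le_opNorm T x)).1
    linarith⟩
  obtain ⟨x₀, hx₀⟩ := exists_ne (0 : H)
  have hbdd : BddAbove s := ⟨⟪T x₀, x₀⟫ / ‖x₀‖ ^ 2, fun c hc => by
    rw [le_div_iff₀ (by positivity)]
    exact hc x₀⟩
  have hcl : IsClosed s := by
    have : s = ⋂ x, {c : ℝ | c * ‖x‖ ^ 2 ≤ ⟪T x, x⟫} := by ext; simp [s]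
    rw [this]
    exact isClosed_iInter fun x => isClosed_le (by fun_prop) (by fun_prop)
  have hm : sSup s ∈ s := hcl.csSup_mem hne hbdd
  refine ⟨sSup s, ⟨?_, fun t ht => le_of_mem_spectrum hm ht⟩, hm⟩
  by_contra hns
  rw [spectrum.notMem_iff, IsUnit.sub_iff] at hns
  set R : H →L[ℝ] H := T - algebraMap ℝ (H →L[ℝ] H) (sSup s)
  have hR : ∀ x, R x = T x - sSup s • x := fun x => by
    simp [R, Algebra.algebraMap_eq_smul_one]
  have hRs : ∀ x y, ⟪R x, y⟫ = ⟪x, R y⟫ := fun x y => by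
    simp [hR, inner_sub_left, inner_sub_right, inner_smul_left, inner_smul_right, hT]
  have hRi : ∀ x, ⟪R x, x⟫ = ⟪T x, x⟫ - sSup s * ‖x‖ ^ 2 := fun x => by
    simp [hR, inner_sub_left, inner_smul_left]
  have hR0 : ∀ x, 0 ≤ ⟪R x, x⟫ := fun x => by rw [hRi]; linarith [hm x]
  -- If the best lower bound were not in the spectrum, `R` would be nonnegative and invertible. Then
  -- `‖x‖ ≤ ‖W‖ ‖R x‖` and `R² ≤ ‖R‖ R` make `R` coercive, so the bound could be raised.
  have hRn := norm_sq_le_of_inner_le hRs hR0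
    (fun x => (le_abs_self _).trans (inner_apply_le_opNorm R x))
  obtain ⟨V, hV⟩ := hns
  set W : H →L[ℝ] H := ↑V⁻¹
  have hW : ∀ x, W (R x) = x := fun x => by
    have : W * R = 1 := by rw [← hV]; exact V.inv_mul
    exact congrArg (fun f : H →L[ℝ] H => f x) this
  have hκ : ∀ x, ‖x‖ ^ 2 ≤ (‖W‖ ^ 2 * ‖R‖) * ⟪R x, x⟫ := fun x => by
    have h1 : ‖x‖ ≤ ‖W‖ * ‖R x‖ := by simpa [hW] using W.le_opNorm (R x)
    calc ‖x‖ ^ 2 ≤ (‖W‖ * ‖R x‖) ^ 2 := by gcongr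
      _ = ‖W‖ ^ 2 * ‖R x‖ ^ 2 := by ring
      _ ≤ ‖W‖ ^ 2 * (‖R‖ * ⟪R x, x⟫) := by gcongr; exact hRn x
      _ = _ := by ring
  set κ := ‖W‖ ^ 2 * ‖R‖ + 1
  have hκ0 : 0 < κ := by positivity
  have hmem : sSup s + κ⁻¹ ∈ s := fun x => by
    have h1 : ‖x‖ ^ 2 ≤ κ * ⟪R x, x⟫ := by
      have := hκ x
      have := hR0 x
      simp only [κ]
      linarith
    have h2 : κ⁻¹ * ‖x‖ ^ 2 ≤ ⟪R x, x⟫ := by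
      rw [inv_mul_le_iff₀ hκ0]
      exact h1
    rw [hRi] at h2
    linarith
  have := le_csSup hbdd hmem
  have : 0 < κ⁻¹ := by positivity
  linarith

theorem inner_nonneg_of_spectrum_nonneg [CompleteSpace H] {T : H →L[ℝ] H}
    (hT : ∀ x y, ⟪T x, y⟫ = ⟪x, T y⟫) (h : ∀ t ∈ spectrum ℝ T, 0 ≤ t) (x : H) :
    0 ≤ ⟪T x, x⟫ := by
  rcases subsingleton_or_nontrivial H with _ | _
  · simp [Subsingleton.elim x 0]
  obtain ⟨m, hm, hb⟩ := exists_isLeast_spectrum hT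
  exact (mul_nonneg (h m hm.1) (by positivity)).trans (hb x)

theorem ker_orthogonal_eq_closure_range [CompleteSpace H] {T : H →L[ℝ] H}
    (hT : ∀ x y, ⟪T x, y⟫ = ⟪x, T y⟫) :
    T.kerᗮ = T.range.topologicalClosure := by
  have h : ContinuousLinearMap.adjoint T = T := by
    symm
    rw [ContinuousLinearMap.eq_adjoint_iff]
    exact hT
  rw [ContinuousLinearMap.orthogonal_ker, h]

/-- A spectral gap above zero of a positive operator makes it coercive off its kernel. -/
theorem coercive_of_spectral_gap [CompleteSpace H] {R : H →L[ℝ] H}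
    (hR : ∀ x y, ⟪R x, y⟫ = ⟪x, R y⟫) (h0 : ∀ x, 0 ≤ ⟪R x, x⟫) {δ : ℝ} (hδ : 0 < δ)
    (hgap : ∀ t ∈ spectrum ℝ R, t ≠ 0 → δ ≤ t) {y : H} (hy : y ∈ R.kerᗮ) :
    δ * ‖y‖ ^ 2 ≤ ⟪R y, y⟫ := by
  -- The polynomial `t² - δ t` is nonnegative on `{0} ∪ [δ, ∞)`, so `P ≥ 0` is to be expected. It is
  -- checked by factoring: for `t < 0`, `P - t` is a product of two factors `R - a` with `a` in the
  -- gap `(0, δ)`.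
  set P : H →L[ℝ] H := R * R - δ • R with hP
  have hPa : ∀ x, P x = R (R x) - δ • R x := fun x => by simp [P]
  have hPs : ∀ x y, ⟪P x, y⟫ = ⟪x, P y⟫ := fun x y => by
    simp only [hPa, inner_sub_left, inner_sub_right, inner_smul_left, inner_smul_right, hR,
      RCLike.conj_to_real]
  have hPi : ∀ x, ⟪P x, x⟫ = ‖R x‖ ^ 2 - δ * ⟪R x, x⟫ := fun x => by
    simp only [hPa, inner_sub_left, inner_smul_left, RCLike.conj_to_real]
    rw [hR (R x) x, real_inner_self_eq_norm_sq]
  have hP0 : ∀ x, 0 ≤ ⟪P x, x⟫ := by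
    refine inner_nonneg_of_spectrum_nonneg hPs fun t ht => ?_
    by_contra! htn
    -- Completing the square, `P + δ²/4 = (R - δ/2)²`. This keeps the roots `(δ ± w)/2` real.
    have hlow : -(δ ^ 2 / 4) ≤ t := by
      refine le_of_mem_spectrum (fun x => ?_) ht
      have h1 : 0 ≤ ‖R x - (δ / 2) • x‖ ^ 2 := by positivity
      rw [norm_sub_sq_real, inner_smul_right, norm_smul, mul_pow, Real.norm_eq_abs, sq_abs] at h1
      rw [hPi]
      linarith
    have hd : 0 ≤ δ ^ 2 + 4 * t := by linarith
    set w := √(δ ^ 2 + 4 * t)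
    have hw : w * w = δ ^ 2 + 4 * t := Real.mul_self_sqrt hd
    have hw0 : 0 ≤ w := Real.sqrt_nonneg _
    have hwδ : w < δ := by nlinarith
    have hu : ∀ a, 0 < a → a < δ → IsUnit (R - algebraMap ℝ (H →L[ℝ] H) a) := fun a ha haδ => by
      rw [← IsUnit.sub_iff, ← spectrum.notMem_iff]
      intro h
      have := hgap a h ha.ne'
      linarith
    have h1 := hu ((δ + w) / 2) (by linarith) (by linarith)
    have h2 := hu ((δ - w) / 2) (by linarith) (by linarith)
    rw [spectrum.mem_iff, IsUnit.sub_iff] at ht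
    apply ht
    convert h1.mul h2 using 1
    ext x
    simp only [hP, Algebra.algebraMap_eq_smul_one, _root_.sub_apply,
      mul_apply_eq_comp, _root_.smul_apply, map_sub, map_smul,
      one_apply_eq_self, smul_sub, smul_smul]
    have : t = -((δ + w) / 2 * ((δ - w) / 2)) := by nlinarith
    rw [this]
    module
  -- Combine `δ ⟪R x, x⟫ ≤ ‖R x‖²` with `‖R x‖⁴ ≤ ⟪R x, x⟫ ⟪R (R x), R x⟫` and cancel. The bound on
  -- the range extends to its closure, the orthogonal complement of the kernel.
  have hrange : ∀ x, δ * ‖R x‖ ^ 2 ≤ ⟪R (R x), R x⟫ := fun x => by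
    have h1 := hP0 x
    rw [hPi] at h1
    have h2 := inner_sq_le_of_nonneg hR h0 x (R x)
    rw [real_inner_self_eq_norm_sq] at h2
    have h3 := h0 (R x)
    rcases (h0 x).eq_or_lt with h4 | h4
    · rw [← h4] at h2
      have : ‖R x‖ ^ 2 = 0 := by nlinarith
      rw [this]
      linarith
    · refine le_of_mul_le_mul_left ?_ h4
      nlinarith [sq_nonneg ‖R x‖]
  rw [ker_orthogonal_eq_closure_range hR] at hy
  have hcl : IsClosed {y : H | δ * ‖y‖ ^ 2 ≤ ⟪R y, y⟫} :=
    isClosed_le (by fun_prop) (by fun_prop)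
  have hsub : (R.range : Set H) ⊆ {y : H | δ * ‖y‖ ^ 2 ≤ ⟪R y, y⟫} := by
    rintro _ ⟨x, rfl⟩
    exact hrange x
  exact hcl.closure_subset_iff.2 hsub hy

/-- If `0 ≤ T ≤ 1 + q < 2`, then the powers of `1 - T` converge strongly to the orthogonal
projection onto the kernel of `T`. -/
theorem tendsto_one_sub_pow [CompleteSpace H] {T : H →L[ℝ] H}
    (hT : ∀ x y, ⟪T x, y⟫ = ⟪x, T y⟫) (h0 : ∀ x, 0 ≤ ⟪T x, x⟫) {c : ℝ} (hc : c < 2)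
    (hc0 : 0 < c)
    (hTc : ∀ x, ⟪T x, x⟫ ≤ c * ‖x‖ ^ 2) (w : H) :
    ∃ ψ ∈ T.ker, Tendsto (fun n : ℕ => ((1 - T) ^ n) w) atTop (𝓝 ψ) := by
  set S : H →L[ℝ] H := 1 - T
  have hSa : ∀ x, S x = x - T x := fun x => by simp [S]
  -- Each step loses energy proportional to `‖T x‖²`. Telescoping makes `∑ ‖T (S ^ k x)‖²` finite,
  -- so `S ^ n` tends to zero on the range of `T`, and on its closure because `S` is a contraction.
  have hSsq : ∀ x, ‖S x‖ ^ 2 ≤ ‖x‖ ^ 2 - (2 / c - 1) * ‖T x‖ ^ 2 := fun x => by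
    rw [hSa, norm_sub_sq_real, real_inner_comm]
    have h1 := norm_sq_le_of_inner_le hT h0 hTc x
    have h2 : ‖T x‖ ^ 2 / c ≤ ⟪T x, x⟫ := by rwa [div_le_iff₀' hc0]
    have h3 : (2 / c - 1) * ‖T x‖ ^ 2 = 2 * (‖T x‖ ^ 2 / c) - ‖T x‖ ^ 2 := by ring
    linarith
  have hκ : 0 < 2 / c - 1 := by
    rw [sub_pos, lt_div_iff₀ hc0]
    linarith
  have hS1 : ∀ x, ‖S x‖ ≤ ‖x‖ := fun x => by
    refine le_of_sq_le_sq ?_ (norm_nonneg _)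
    have := hSsq x
    have : 0 ≤ (2 / c - 1) * ‖T x‖ ^ 2 := by positivity
    linarith
  have hpow : ∀ n x, (S ^ (n + 1)) x = S ((S ^ n) x) := fun n x => by
    rw [pow_succ', mul_apply_eq_comp]
  have hSn : ∀ n x, ‖(S ^ n) x‖ ≤ ‖x‖ := fun n x => by
    induction n with
    | zero => simp
    | succ n ih => rw [hpow]; exact (hS1 _).trans ih
  have hTS : ∀ n x, T ((S ^ n) x) = (S ^ n) (T x) := fun n x => by
    have : Commute T (S ^ n) := ((Commute.one_right T).sub_right (Commute.refl T)).pow_right n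
    exact congrArg (fun f : H →L[ℝ] H => f x) this.eq
  have hsum : ∀ x n, (2 / c - 1) * ∑ k ∈ Finset.range n, ‖T ((S ^ k) x)‖ ^ 2 ≤
      ‖x‖ ^ 2 - ‖(S ^ n) x‖ ^ 2 := fun x n => by
    induction n with
    | zero => simp
    | succ n ih =>
      rw [Finset.sum_range_succ, hpow]
      have := hSsq ((S ^ n) x)
      linarith
  have htend : ∀ x, Tendsto (fun n : ℕ => (S ^ n) (T x)) atTop (𝓝 0) := fun x => by
    have hs : Summable fun k : ℕ => ‖T ((S ^ k) x)‖ ^ 2 := by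
      refine summable_of_sum_range_le (c := ‖x‖ ^ 2 / (2 / c - 1)) (fun _ => by positivity)
        fun n => ?_
      rw [le_div_iff₀' hκ]
      have := hsum x n
      have : 0 ≤ ‖(S ^ n) x‖ ^ 2 := by positivity
      linarith
    have h1 := hs.tendsto_atTop_zero
    rw [tendsto_zero_iff_norm_tendsto_zero]
    have h2 := (Real.continuous_sqrt.tendsto 0).comp h1
    simp only [Real.sqrt_zero] at h2
    refine h2.congr fun n => ?_
    rw [Function.comp_apply, Real.sqrt_sq (norm_nonneg _), hTS]
  have hcl : ∀ y ∈ T.kerᗮ, Tendsto (fun n : ℕ => (S ^ n) y) atTop (𝓝 0) := fun y hy => by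
    rw [ker_orthogonal_eq_closure_range hT] at hy
    have hy' : y ∈ closure (T.range : Set H) := hy
    rw [Metric.tendsto_atTop]
    intro ε hε
    obtain ⟨_, ⟨x, rfl⟩, hz⟩ := Metric.mem_closure_iff.1 hy' (ε / 2) (half_pos hε)
    obtain ⟨N, hN⟩ := Metric.tendsto_atTop.1 (htend x) (ε / 2) (half_pos hε)
    refine ⟨N, fun n hn => ?_⟩
    have h1 := hN n hn
    rw [dist_zero_right] at h1 ⊢
    rw [dist_eq_norm] at hz
    have h2 := hSn n (y - T x)
    have h3 : (S ^ n) y = (S ^ n) (y - T x) + (S ^ n) (T x) := by rw [map_sub]; abel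
    rw [h3]
    refine (norm_add_le _ _).trans_lt ?_
    have : ‖y - T x‖ < ε / 2 := hz
    linarith
  have hker : IsClosed (T.ker : Set H) := T.isClosed_ker
  have : CompleteSpace T.ker := hker.completeSpace_coe
  obtain ⟨ψ, hψ, y, hy, rfl⟩ := T.ker.exists_add_mem_mem_orthogonal w
  refine ⟨ψ, hψ, ?_⟩
  have hfix : ∀ n, (S ^ n) ψ = ψ := fun n => by
    induction n with
    | zero => simp
    | succ n ih =>
      rw [hpow, ih, hSa]
      have : T ψ = 0 := hψ
      simp [this]
  have h1 := (hcl y hy).const_add ψ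
  rw [add_zero] at h1
  exact h1.congr fun n => by rw [map_add, hfix]

end Spectral

/-! ### Nonlinear iterations near a fixed point -/

section Dynamics

theorem exists_ball_strict_estimate {E G : Type*} [NormedAddCommGroup E] [NormedSpace ℝ E]
    [NormedAddCommGroup G] [NormedSpace ℝ G] {F : E → G} {S : E →L[ℝ] G} {z : E}
    (hF : HasStrictFDerivAt F S z) {η : ℝ} (hη : 0 < η) :
    ∃ ρ > 0, ∀ x ∈ Metric.ball z ρ, ∀ y ∈ Metric.ball z ρ,
      ‖F x - F y - S (x - y)‖ ≤ η * ‖x - y‖ := by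
  have h := hF.isLittleO.def hη
  rw [nhds_prod_eq, eventually_prod_self_iff'] at h
  obtain ⟨t, ht, h⟩ := h
  obtain ⟨ρ, hρ, hsub⟩ := Metric.mem_nhds_iff.1 ht
  exact ⟨ρ, hρ, fun x hx y hy => h x (hsub hx) y (hsub hy)⟩

/-- If the displacement `F x - x` contracts along orbits in a ball, then an orbit that starts well
inside the ball converges to a fixed point in the ball. -/
theorem exists_tendsto_iterate_of_displacement_contracts {E : Type*} [NormedAddCommGroup E]
    [CompleteSpace E] {F : E → E} {z x₀ : E} {σ ρ : ℝ} (hσ0 : 0 ≤ σ) (hσ : σ < 1)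
    (hcont : ContinuousOn F (Metric.ball z ρ))
    (hF : ∀ x ∈ Metric.ball z ρ, F x ∈ Metric.ball z ρ → ‖F (F x) - F x‖ ≤ σ * ‖F x - x‖)
    (hx₀ : ‖x₀ - z‖ + ‖F x₀ - x₀‖ / (1 - σ) < ρ) :
    ∃ y ∈ Metric.ball z ρ, F y = y ∧ Tendsto (fun n : ℕ => F^[n] x₀) atTop (𝓝 y) := by
  have h1 : 0 < 1 - σ := sub_pos.2 hσ
  -- `‖x - z‖ + ‖F x - x‖ / (1 - σ)` does not increase along the orbit: the second term bounds the
  -- total length of all remaining steps. This traps the orbit in the ball.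
  set B := ‖x₀ - z‖ + ‖F x₀ - x₀‖ / (1 - σ) with hB
  have hle : ∀ d : ℝ, 0 ≤ d → d ≤ d / (1 - σ) := fun d hd => by
    rw [le_div_iff₀ h1]
    nlinarith
  have step : ∀ x, ‖x - z‖ + ‖F x - x‖ / (1 - σ) ≤ B →
      ‖F (F x) - F x‖ ≤ σ * ‖F x - x‖ ∧ ‖F x - z‖ + ‖F (F x) - F x‖ / (1 - σ) ≤ B := by
    intro x hx
    have hd := hle _ (norm_nonneg (F x - x))
    have htri : ‖F x - z‖ ≤ ‖x - z‖ + ‖F x - x‖ := by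
      have : F x - z = (x - z) + (F x - x) := by abel
      rw [this]
      exact norm_add_le _ _
    have hc := hF x (mem_ball_iff_norm.2 (by linarith [norm_nonneg (F x - x)]))
      (mem_ball_iff_norm.2 (by linarith))
    refine ⟨hc, ?_⟩
    have h2 : ‖F (F x) - F x‖ / (1 - σ) ≤ σ * ‖F x - x‖ / (1 - σ) := by gcongr
    have h3 : ‖F x - x‖ + σ * ‖F x - x‖ / (1 - σ) = ‖F x - x‖ / (1 - σ) := by
      field_simp
      ring
    linarith
  have hinv : ∀ n : ℕ, ‖F^[n] x₀ - z‖ + ‖F (F^[n] x₀) - F^[n] x₀‖ / (1 - σ) ≤ B := by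
    intro n
    induction n with
    | zero => simp [hB]
    | succ n ih =>
      rw [Function.iterate_succ_apply']
      exact (step _ ih).2
  have hgeo : ∀ n : ℕ, dist (F^[n] x₀) (F^[n + 1] x₀) ≤ ‖F x₀ - x₀‖ * σ ^ n := by
    intro n
    rw [dist_comm, dist_eq_norm, Function.iterate_succ_apply']
    induction n with
    | zero => simp
    | succ n ih =>
      rw [Function.iterate_succ_apply']
      refine (step _ (hinv n)).1.trans ?_
      rw [pow_succ]
      nlinarith
  obtain ⟨y, hy⟩ := cauchySeq_tendsto_of_complete (cauchySeq_of_le_geometric σ _ hσ hgeo)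
  have hyB : y ∈ Metric.ball z ρ := by
    rw [mem_ball_iff_norm]
    refine lt_of_le_of_lt (le_of_tendsto (hy.sub_const z).norm (Eventually.of_forall fun n => ?_))
      hx₀
    have h2 : 0 ≤ ‖F (F^[n] x₀) - F^[n] x₀‖ / (1 - σ) := by positivity
    linarith [hinv n]
  exact ⟨y, hyB, isFixedPt_of_tendsto_iterate hy
    (hcont.continuousAt (Metric.isOpen_ball.mem_nhds hyB)), hy⟩

/-- An orbit of a map whose linearization expands some directions leaves a fixed neighbourhood of
the fixed point, provided that the map differs from its linearization by a quadratic term. -/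
theorem exists_escaping_orbit {E : Type*} [NormedAddCommGroup E] [NormedSpace ℝ E]
    {F : E → E} {z : E} {S : E →L[ℝ] E} {C ρ : ℝ} (hC : 0 < C) (hρ : 0 < ρ)
    (hF : ∀ x ∈ Metric.ball z ρ, ‖F x - z - S (x - z)‖ ≤ C * ‖x - z‖ ^ 2)
    (hS : 1 < ‖S‖) (hpow : ∀ k : ℕ, ‖S ^ 2 ^ k‖ = ‖S‖ ^ 2 ^ k) :
    ∃ ε > 0, ∀ δ > 0, ∃ x₀, ‖x₀ - z‖ < δ ∧ ∃ n : ℕ, ε ≤ ‖F^[n] x₀ - z‖ := by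
  set l := ‖S‖
  have hl : 0 < l ^ 2 - l := by nlinarith
  -- Chosen so that `4 C + l κ = κ l²`, which closes the induction `hmain` for the deviation from
  -- the linear orbit.
  set κ := 4 * C / (l ^ 2 - l)
  have hκ : 0 < κ := by positivity
  have hκl : κ * (l ^ 2 - l) = 4 * C := div_mul_cancel₀ _ hl.ne'
  set a := min (ρ / 4) (1 / (4 * κ))
  have ha : 0 < a := by positivity
  have haρ : 2 * a < ρ := by
    have : a ≤ ρ / 4 := min_le_left _ _
    linarith
  have haκ : κ * a ≤ 1 / 4 := by
    have : a ≤ 1 / (4 * κ) := min_le_right _ _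
    calc κ * a ≤ κ * (1 / (4 * κ)) := by gcongr
      _ = 1 / 4 := by field_simp
  refine ⟨a / 4, by positivity, fun δ hδ => ?_⟩
  obtain ⟨N, hN⟩ := pow_unbounded_of_one_lt (a / δ) hS
  -- The norm of `S ^ m` is known only for `m` a power of two. The starting size `b` is scaled so
  -- that linear growth reaches exactly `a` at time `m`.
  set m := 2 ^ N
  have hm : a / δ < l ^ m := hN.trans_le (pow_le_pow_right₀ hS.le N.lt_two_pow_self.le)
  have hlm : 0 < l ^ m := by positivity
  set b := a / l ^ m
  have hb : 0 < b := by positivity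
  have hbm : b * l ^ m = a := div_mul_cancel₀ _ hlm.ne'
  have hbδ : b < δ := by
    rw [div_lt_iff₀ hδ] at hm
    rw [div_lt_iff₀ hlm]
    linarith
  obtain ⟨v, hv1, hv⟩ := (S ^ m).exists_lt_apply_of_lt_opNorm (r := l ^ m / 2)
    (by rw [hpow]; linarith)
  have hSn : ∀ n : ℕ, ‖(S ^ n) (b • v)‖ ≤ b * l ^ n := fun n => by
    induction n with
    | zero =>
      rw [pow_zero, pow_zero, one_apply_eq_self, norm_smul, Real.norm_of_nonneg hb.le]
      gcongr
    | succ n ih =>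
      rw [pow_succ', mul_apply_eq_comp]
      calc _ ≤ l * ‖(S ^ n) (b • v)‖ := S.le_opNorm _
        _ ≤ l * (b * l ^ n) := by gcongr
        _ = b * l ^ (n + 1) := by ring
  have hmain : ∀ n ≤ m, ‖F^[n] (z + b • v) - z - (S ^ n) (b • v)‖ ≤ κ * (b * l ^ n) ^ 2 := by
    intro n
    induction n with
    | zero => intro _; simp; positivity
    | succ n ih =>
      intro hn
      have ih := ih (by omega)
      rw [Function.iterate_succ_apply']
      set x := F^[n] (z + b • v)
      have hbn : b * l ^ n ≤ a := by
        rw [← hbm]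
        gcongr
        · exact hS.le
        · omega
      have hbn0 : 0 < b * l ^ n := by positivity
      have h1 : κ * (b * l ^ n) ^ 2 ≤ b * l ^ n := by
        have : κ * (b * l ^ n) ≤ κ * a := by gcongr
        nlinarith
      have hx : ‖x - z‖ ≤ 2 * (b * l ^ n) := by
        have := norm_le_norm_sub_add (x - z) ((S ^ n) (b • v))
        linarith [hSn n]
      have h2 := hF x (mem_ball_iff_norm.2 (by linarith))
      have h3 : F x - z - (S ^ (n + 1)) (b • v) =
          (F x - z - S (x - z)) + S (x - z - (S ^ n) (b • v)) := by
        rw [pow_succ', mul_apply_eq_comp, map_sub S (x - z)]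
        abel
      rw [h3]
      calc _ ≤ C * ‖x - z‖ ^ 2 + l * (κ * (b * l ^ n) ^ 2) :=
            norm_add_le_of_le h2 ((S.le_opNorm _).trans (by gcongr))
        _ ≤ C * (2 * (b * l ^ n)) ^ 2 + l * (κ * (b * l ^ n) ^ 2) := by gcongr
        _ = (4 * C + l * κ) * (b * l ^ n) ^ 2 := by ring
        _ = κ * (b * l ^ (n + 1)) ^ 2 := by rw [← hκl]; ring
  refine ⟨z + b • v, ?_, m, ?_⟩
  · rw [add_sub_cancel_left, norm_smul, Real.norm_of_nonneg hb.le]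
    nlinarith
  · have h1 := hmain m le_rfl
    rw [hbm] at h1
    have h2 : a / 2 ≤ ‖(S ^ m) (b • v)‖ := by
      rw [map_smul, norm_smul, Real.norm_of_nonneg hb.le]
      have : b * (l ^ m / 2) ≤ b * ‖(S ^ m) v‖ := by gcongr
      linarith
    have h3 := norm_le_norm_sub_add ((S ^ m) (b • v)) (F^[m] (z + b • v) - z)
    rw [norm_sub_rev] at h3
    nlinarith

variable {H : Type*} [NormedAddCommGroup H] [InnerProductSpace ℝ H]

local notation "⟪" x ", " y "⟫" => inner ℝ x y

theorem map_mem_orthogonal {S : H →L[ℝ] H} (hS : ∀ x y, ⟪S x, y⟫ = ⟪x, S y⟫)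
    {K : Submodule ℝ H} (hK : ∀ k ∈ K, S k ∈ K) {y : H} (hy : y ∈ Kᗮ) : S y ∈ Kᗮ := by
  rw [Submodule.mem_orthogonal] at hy ⊢
  intro k hk
  rw [← hS]
  exact hy _ (hK k hk)

/-- Local convergence to a family of fixed points: the linearization fixes `K` and contracts its
orthogonal complement, and every point near `z` lies over a member of the family. -/
theorem tendsto_iterate_of_normally_contracting [CompleteSpace H] {P : Type*} [TopologicalSpace P]
    {F : H → H} {z : H} {S : H →L[ℝ] H} (hF : HasStrictFDerivAt F S z) (hz : F z = z)
    (hS : ∀ x y, ⟪S x, y⟫ = ⟪x, S y⟫) {K : Submodule ℝ H} (hK : ∀ k ∈ K, S k = k)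
    {ρ : ℝ} (hρ0 : 0 ≤ ρ) (hρ : ρ < 1) (hSK : ∀ y ∈ Kᗮ, ‖S y‖ ≤ ρ * ‖y‖)
    {U : P → H} {p₀ : P} (hU : ContinuousAt U p₀) (hU0 : U p₀ = z) {good : P → Prop}
    (hgood : ∀ N ∈ 𝓝 p₀, ∀ᶠ x in 𝓝 z, ∃ p ∈ N, good p ∧ F (U p) = U p ∧ x - U p ∈ Kᗮ) :
    ∀ N ∈ 𝓝 p₀, ∀ᶠ x in 𝓝 z, ∃ p ∈ N, good p ∧
      Tendsto (fun n : ℕ => F^[n] x) atTop (𝓝 (U p)) := by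
  intro N hN
  have h1ρ : 0 < 1 - ρ := sub_pos.2 hρ
  set c := ‖S‖
  have hc : 0 ≤ c := norm_nonneg _
  -- One factor `1 - ρ` pays for `‖x - U p‖ ≤ 2 / (1 - ρ) ‖F x - x‖`, the other for the room between
  -- `ρ` and `σ = (1 + ρ) / 2`.
  set η := (1 - ρ) ^ 2 / (8 * (1 + c + ρ)) with hη_def
  have hη : 0 < η := by positivity
  have hη1 : η * (1 + c + ρ) = (1 - ρ) ^ 2 / 8 := by
    rw [hη_def]
    field_simp
  have hη2 : η ≤ (1 - ρ) / 8 := by nlinarith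
  obtain ⟨r, hr, hest⟩ := exists_ball_strict_estimate hF hη
  have hN' : N ∩ U ⁻¹' Metric.ball z r ∈ 𝓝 p₀ :=
    inter_mem hN (hU.preimage_mem_nhds (by rw [hU0]; exact Metric.ball_mem_nhds z hr))
  obtain ⟨t, ht, hgt⟩ := Metric.eventually_nhds_iff_ball.1 (hgood _ hN')
  set r' := min r t
  have hr' : 0 < r' := lt_min hr ht
  have hbr : Metric.ball z r' ⊆ Metric.ball z r := Metric.ball_subset_ball (min_le_left _ _)
  have hbt : Metric.ball z r' ⊆ Metric.ball z t := Metric.ball_subset_ball (min_le_right _ _)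
  -- the displacement controls the distance to the fixed point below
  have hdisp : ∀ x ∈ Metric.ball z r', ∃ p ∈ N, good p ∧ F (U p) = U p ∧ x - U p ∈ Kᗮ ∧
      ‖F x - U p - S (x - U p)‖ ≤ η * ‖x - U p‖ ∧
      (1 - ρ - η) * ‖x - U p‖ ≤ ‖F x - x‖ := by
    intro x hx
    obtain ⟨p, hp, hg, hfix, hperp⟩ := hgt x (hbt hx)
    have h1 := hest x (hbr hx) (U p) hp.2
    rw [hfix] at h1
    refine ⟨p, hp.1, hg, hfix, hperp, h1, ?_⟩
    have h2 := hSK _ hperp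
    have h3 : x - U p = S (x - U p) + (F x - U p - S (x - U p)) - (F x - x) := by abel
    have h4 : ‖x - U p‖ ≤ ‖S (x - U p)‖ + ‖F x - U p - S (x - U p)‖ + ‖F x - x‖ := by
      conv_lhs => rw [h3]
      exact (norm_sub_le _ _).trans (by gcongr; exact norm_add_le _ _)
    linarith
  set σ := (1 + ρ) / 2
  -- `F x - x` equals `S y - y`, which lies in `Kᗮ` and is contracted by `S`, up to an error `e`
  -- that is small relative to `‖y‖` and hence to the displacement itself.
  have hcontr : ∀ x ∈ Metric.ball z r', F x ∈ Metric.ball z r' →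
      ‖F (F x) - F x‖ ≤ σ * ‖F x - x‖ := by
    intro x hx hFx
    obtain ⟨p, -, -, -, hperp, h1, h2⟩ := hdisp x hx
    have h3 := hest _ (hbr hFx) _ (hbr hx)
    set y := x - U p
    set e := F x - U p - S y
    have hd : F x - x = (S y - y) + e := by simp only [e, y]; abel
    have hSy : S y ∈ Kᗮ := map_mem_orthogonal hS (fun k hk => by rwa [hK k hk]) hperp
    have h4 := hSK _ (Submodule.sub_mem _ hSy hperp)
    have h5 : ‖S y - y‖ ≤ ‖F x - x‖ + ‖e‖ := by
      have : S y - y = (F x - x) - e := by rw [hd]; abel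
      rw [this]
      exact norm_sub_le _ _
    have h6 : ‖S (F x - x)‖ ≤ ρ * (‖F x - x‖ + ‖e‖) + c * ‖e‖ := by
      rw [hd, map_add]
      refine norm_add_le_of_le (h4.trans ?_) (S.le_opNorm e)
      rw [← hd]
      gcongr
    have h7 : ‖F (F x) - F x‖ ≤ η * ‖F x - x‖ + ‖S (F x - x)‖ := by
      have := norm_le_norm_sub_add (F (F x) - F x) (S (F x - x))
      linarith
    have h8 : (1 - ρ) / 2 * ‖y‖ ≤ ‖F x - x‖ := by
      refine le_trans ?_ h2
      gcongr
      linarith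
    have h9 : (ρ + c) * ‖e‖ ≤ (1 - ρ) / 4 * ‖F x - x‖ := by
      calc (ρ + c) * ‖e‖ ≤ (ρ + c) * (η * ‖y‖) := by gcongr
        _ = (η * (ρ + c)) * ‖y‖ := by ring
        _ ≤ ((1 - ρ) ^ 2 / 8) * ‖y‖ := by
          gcongr
          linarith
        _ = (1 - ρ) / 4 * ((1 - ρ) / 2 * ‖y‖) := by ring
        _ ≤ _ := by gcongr
    have h10 : η * ‖F x - x‖ ≤ (1 - ρ) / 8 * ‖F x - x‖ := by gcongr
    have h11 : 0 ≤ (1 - ρ) * ‖F x - x‖ := by positivity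
    simp only [σ]
    linarith
  have hcont : ContinuousOn F (Metric.ball z r') := by
    have : LipschitzOnWith (Real.toNNReal (η + c)) F (Metric.ball z r') :=
      LipschitzOnWith.of_dist_le_mul fun x hx y hy => by
        rw [Real.coe_toNNReal _ (by positivity), dist_eq_norm, dist_eq_norm]
        have h1 := hest x (hbr hx) y (hbr hy)
        have h2 := norm_le_norm_sub_add (F x - F y) (S (x - y))
        have h3 := S.le_opNorm (x - y)
        linarith
    exact this.continuousOn
  have hev : ∀ᶠ x in 𝓝 z, ‖x - z‖ + ‖F x - x‖ / (1 - σ) < r' := by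
    have hFc : ContinuousAt F z := hF.continuousAt
    have : ContinuousAt (fun x => ‖x - z‖ + ‖F x - x‖ / (1 - σ)) z := by fun_prop
    refine this.eventually_lt continuousAt_const ?_
    simpa [hz] using hr'
  filter_upwards [hev] with x hx
  obtain ⟨y, hy, hfix, hlim⟩ := exists_tendsto_iterate_of_displacement_contracts
    (by positivity) (by simp only [σ]; linarith) hcont hcontr hx
  -- At a fixed point the displacement is zero, so the limit coincides with the family member below
  -- it.
  obtain ⟨p, hp, hg, -, -, -, h2⟩ := hdisp y hy
  rw [hfix, sub_self, norm_zero] at h2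
  have h3 : ‖y - U p‖ = 0 := by
    have := norm_nonneg (y - U p)
    nlinarith
  rw [norm_sub_eq_zero_iff] at h3
  exact ⟨p, hp, hg, h3 ▸ hlim⟩

/-- If the linearization has an eigenspace `K` for `-l`, with `l > 1` dominating the rest of the
spectrum, then the points whose orbits stay near the fixed point form a set with empty interior. -/
theorem exists_interior_trapped_eq_empty {F : H → H} {z : H} {S : H →L[ℝ] H}
    (hF : HasStrictFDerivAt F S z)
    (hS : ∀ x y, ⟪S x, y⟫ = ⟪x, S y⟫) {K : Submodule ℝ H} [K.HasOrthogonalProjection]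
    (hne : K ≠ ⊥) {l ρ : ℝ} (hl : 1 < l) (hρ : ρ < l) (hρ0 : 0 ≤ ρ)
    (hK : ∀ k ∈ K, S k = -(l • k)) (hSK : ∀ y ∈ Kᗮ, ‖S y‖ ≤ ρ * ‖y‖) :
    ∃ ε > 0, interior {x | ∀ n : ℕ, ‖F^[n] x - z‖ < ε} = ∅ := by
  -- The first bound keeps the cone `‖d - P d‖ ≤ ‖P d‖` invariant (`l - 4 η - ρ ≥ 0`); the second
  -- keeps the expansion factor `l - 2 η` above `1`.
  set η := min ((l - ρ) / 4) ((l - 1) / 4)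
  have hη : 0 < η := lt_min (by linarith) (by linarith)
  have hη1 : η ≤ (l - ρ) / 4 := min_le_left _ _
  have hη2 : η ≤ (l - 1) / 4 := min_le_right _ _
  obtain ⟨ε, hε, hest⟩ := exists_ball_strict_estimate hF hη
  refine ⟨ε, hε, ?_⟩
  set P : H →L[ℝ] H := K.starProjection
  have hPle : ∀ v, ‖P v‖ ≤ ‖v‖ := fun v => K.norm_starProjection_apply_le v
  have hQ : ∀ v, v - P v ∈ Kᗮ := fun v => K.sub_starProjection_mem_orthogonal v
  have hPm : ∀ v, P v ∈ K := fun v => K.starProjection_apply_mem v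
  have hP0 : ∀ v ∈ Kᗮ, P v = 0 := fun v hv => (K.starProjection_apply_eq_zero_iff).2 hv
  have hPS : ∀ d, P (S d) = -(l • P d) := fun d => by
    have h1 : S d = -(l • P d) + S (d - P d) := by rw [map_sub, hK _ (hPm d)]; abel
    have h2 : -(l • P d) ∈ K := K.neg_mem (K.smul_mem _ (hPm d))
    rw [h1, map_add, hP0 _ (map_mem_orthogonal hS
      (fun k hk => by rw [hK k hk]; exact K.neg_mem (K.smul_mem _ hk)) (hQ d)), add_zero]
    exact K.starProjection_eq_self_iff.2 h2
  -- the cone is mapped into itself, and the differences in it expand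
  have hcone : ∀ x ∈ Metric.ball z ε, ∀ y ∈ Metric.ball z ε,
      ‖(x - y) - P (x - y)‖ ≤ ‖P (x - y)‖ →
      ‖(F x - F y) - P (F x - F y)‖ ≤ ‖P (F x - F y)‖ ∧
      (l - 2 * η) * ‖P (x - y)‖ ≤ ‖P (F x - F y)‖ := by
    intro x hx y hy hxy
    have h1 := hest x hx y hy
    set d := x - y
    set e := F x - F y - S d
    have hFd : F x - F y = S d + e := by simp only [e]; abel
    have hd : ‖d‖ ≤ 2 * ‖P d‖ := by
      have := norm_le_norm_sub_add d (P d)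
      linarith
    have he : ‖e‖ ≤ 2 * η * ‖P d‖ := by nlinarith
    have h2 : (l - 2 * η) * ‖P d‖ ≤ ‖P (F x - F y)‖ := by
      rw [hFd, map_add, hPS]
      have h3 := norm_sub_le (-(l • P d) + P e) (P e)
      rw [add_sub_cancel_right, norm_neg, norm_smul, Real.norm_of_nonneg (by linarith)] at h3
      linarith [hPle e]
    refine ⟨le_trans ?_ h2, h2⟩
    have h4 : (F x - F y) - P (F x - F y) = S (d - P d) + (e - P e) := by
      rw [hFd, map_add, hPS, map_sub S d, hK _ (hPm d)]
      abel
    have h5 : ‖e - P e‖ ≤ ‖e‖ := by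
      have := K.norm_sq_eq_add_norm_sq_starProjection e
      refine le_of_sq_le_sq ?_ (norm_nonneg _)
      rw [K.starProjection_orthogonal_val] at this
      have h6 : 0 ≤ ‖P e‖ ^ 2 := by positivity
      change ‖e - K.starProjection e‖ ^ 2 ≤ _
      nlinarith
    rw [h4]
    refine (norm_add_le_of_le (hSK _ (hQ d)) h5).trans ?_
    have h7 : ρ * ‖d - P d‖ ≤ ρ * ‖P d‖ := by gcongr
    have h8 : 0 ≤ (l - 4 * η - ρ) * ‖P d‖ := mul_nonneg (by linarith) (norm_nonneg _)
    linarith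
  rw [Set.eq_empty_iff_forall_notMem]
  intro x hx
  -- Near an interior trapped point `x`, some `x + t k` with `k ∈ K` is trapped as well. Their
  -- difference starts in the cone and grows geometrically, which is impossible.
  obtain ⟨k, hkK, hk0⟩ := K.exists_mem_ne_zero_of_ne_bot hne
  have hnear : ∀ᶠ t : ℝ in 𝓝 0, x + t • k ∈ {x | ∀ n : ℕ, ‖F^[n] x - z‖ < ε} := by
    have hc : ContinuousAt (fun t : ℝ => x + t • k) 0 := by fun_prop
    exact hc.preimage_mem_nhds (by simpa using mem_interior_iff_mem_nhds.1 hx)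
  obtain ⟨t, ht0, ht⟩ : ∃ t : ℝ, t ≠ 0 ∧ x + t • k ∈ {x | ∀ n : ℕ, ‖F^[n] x - z‖ < ε} := by
    have h1 : ∀ᶠ t : ℝ in 𝓝[≠] 0, x + t • k ∈ {x | ∀ n : ℕ, ‖F^[n] x - z‖ < ε} :=
      hnear.filter_mono nhdsWithin_le_nhds
    obtain ⟨t, h2, h3⟩ := (h1.and self_mem_nhdsWithin).exists
    exact ⟨t, h3, h2⟩
  have hxm : ∀ n : ℕ, ‖F^[n] x - z‖ < ε := interior_subset hx
  have hPk : P (t • k) = t • k := K.starProjection_eq_self_iff.2 (K.smul_mem _ hkK)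
  have hmain : ∀ n : ℕ,
      ‖(F^[n] (x + t • k) - F^[n] x) - P (F^[n] (x + t • k) - F^[n] x)‖ ≤
        ‖P (F^[n] (x + t • k) - F^[n] x)‖ ∧
      (l - 2 * η) ^ n * ‖t • k‖ ≤ ‖P (F^[n] (x + t • k) - F^[n] x)‖ := by
    intro n
    induction n with
    | zero => simp [hPk]
    | succ n ih =>
      rw [Function.iterate_succ_apply', Function.iterate_succ_apply']
      obtain ⟨h1, h2⟩ := hcone _ (mem_ball_iff_norm.2 (ht n)) _
        (mem_ball_iff_norm.2 (hxm n)) ih.1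
      refine ⟨h1, le_trans ?_ h2⟩
      have h3 : 0 ≤ l - 2 * η := by linarith
      calc (l - 2 * η) ^ (n + 1) * ‖t • k‖ = (l - 2 * η) * ((l - 2 * η) ^ n * ‖t • k‖) := by ring
        _ ≤ _ := by gcongr; exact ih.2
  have htk : 0 < ‖t • k‖ := norm_pos_iff.2 (smul_ne_zero ht0 hk0)
  obtain ⟨n, hn⟩ := pow_unbounded_of_one_lt (2 * ε / ‖t • k‖) (show 1 < l - 2 * η by linarith)
  rw [div_lt_iff₀ htk] at hn
  have h1 := (hmain n).2.trans (hPle _)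
  have h2 : ‖F^[n] (x + t • k) - F^[n] x‖ ≤ ‖F^[n] (x + t • k) - z‖ + ‖F^[n] x - z‖ := by
    have : F^[n] (x + t • k) - F^[n] x = (F^[n] (x + t • k) - z) - (F^[n] x - z) := by abel
    rw [this]
    exact norm_sub_le _ _
  have h3 : ‖F^[n] (x + t • k) - z‖ < ε := ht n
  linarith [hxm n]

end Dynamics

/-! ### Algebra of `𝓛_QC`: symmetry, sign and kernel -/

variable {X : Type*} [NormedAddCommGroup X] [NormedSpace ℝ X]

namespace AccelerationOperator

variable (M : AccelerationOperator X)

theorem op_inv (f : StrongDual ℝ X) : M.op (M.inv f) = f := M.op.apply_symm_apply f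

theorem inv_op (φ : X) : M.inv (M.op φ) = φ := M.op.symm_apply_apply φ

theorem apply_inv_comm (f g : StrongDual ℝ X) : f (M.inv g) = g (M.inv f) := by
  conv_lhs => rw [← M.op_inv f]
  conv_rhs => rw [← M.op_inv g]
  exact M.hermitian _ _

theorem apply_inv_self_nonneg (f : StrongDual ℝ X) : 0 ≤ f (M.inv f) := by
  rcases eq_or_ne f 0 with rfl | hf
  · simp
  · have h : M.inv f ≠ 0 := fun h => hf (by rw [← M.op_inv f, h, map_zero])
    have := M.posDef _ h
    rw [M.op_inv] at this
    exact this.le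

theorem eq_zero_of_apply_inv_self {f : StrongDual ℝ X} (h : f (M.inv f) = 0) : f = 0 := by
  by_contra hf
  have h' : M.inv f ≠ 0 := fun h => hf (by rw [← M.op_inv f, h, map_zero])
  have := M.posDef _ h'
  rw [M.op_inv] at this
  exact this.ne' h

end AccelerationOperator

namespace ConstrainedEquation

variable {r : ℕ} (E : ConstrainedEquation X r) (M : AccelerationOperator X)

theorem L1adj_apply (μ : Fin r → ℝ) (u φ ψ : X) : E.L1adj μ u φ ψ = E.L1 μ u ψ φ := rfl

theorem apply_B_inv_sum (u : X) (i : Fin r) (a : Fin r → ℝ) :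
    E.B i u (M.inv (∑ j, a j • E.B j u)) = (E.gram M u *ᵥ a) i := by
  simp [gram, Matrix.mulVec, dotProduct, map_sum, mul_comm]

/-- A null vector `a` of the Gram matrix gives `f = ∑ aⱼ Bⱼ` with `f (M⁻¹ f) = 0`, and `M⁻¹` is
definite. -/
theorem gram_det_ne_zero {u : X} (hB : LinearIndependent ℝ fun j => E.B j u) :
    (E.gram M u).det ≠ 0 := by
  intro h
  obtain ⟨a, ha, h0⟩ := Matrix.exists_mulVec_eq_zero_iff.2 h
  apply ha
  have h1 : ∑ j, a j • E.B j u = 0 := by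
    apply M.eq_zero_of_apply_inv_self
    conv_lhs => rw [_root_.sum_apply]
    refine Finset.sum_eq_zero fun i _ => ?_
    rw [_root_.smul_apply, apply_B_inv_sum, h0]
    simp
  exact funext (Fintype.linearIndependent_iff.1 hB a h1)

theorem coeff_sub_sum {u : X} (hG : (E.gram M u).det ≠ 0) (f : StrongDual ℝ X) (a : Fin r → ℝ) :
    E.coeff M u (f - ∑ j, a j • E.B j u) = E.coeff M u f - a := by
  have h : (fun i => E.B i u (M.inv (f - ∑ j, a j • E.B j u))) =
      (fun i => E.B i u (M.inv f)) - E.gram M u *ᵥ a := by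
    ext i
    rw [map_sub, map_sub, apply_B_inv_sum, Pi.sub_apply]
  rw [coeff, h, Matrix.mulVec_sub, Matrix.mulVec_mulVec,
    Matrix.nonsing_inv_mul _ (isUnit_iff_ne_zero.2 hG), Matrix.one_mulVec, coeff]

theorem B_apply_inv_sub_projB {u : X} (hG : (E.gram M u).det ≠ 0) (f : StrongDual ℝ X)
    (i : Fin r) : E.B i u (M.inv (f - E.projB M u f)) = 0 := by
  rw [projB_apply, map_sub, map_sub, apply_B_inv_sum, coeff, Matrix.mulVec_mulVec,
    Matrix.mul_nonsing_inv _ (isUnit_iff_ne_zero.2 hG), Matrix.one_mulVec, sub_self]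

/-- The complement of `projB` is orthogonal to every `Bᵢ` for `⟨·, M⁻¹ ·⟩`, so the projection may be
inserted on the other side too. -/
theorem apply_inv_sub_projB {u : X} (hG : (E.gram M u).det ≠ 0) (f g : StrongDual ℝ X) :
    f (M.inv (g - E.projB M u g)) =
      (f - E.projB M u f) (M.inv (g - E.projB M u g)) := by
  rw [_root_.sub_apply, E.projB_apply M u f, _root_.sum_apply,
    Finset.sum_eq_zero (fun i _ => ?_), sub_zero]
  rw [_root_.smul_apply, B_apply_inv_sub_projB E M hG, smul_zero]

/-- With the propagation constants assigned to the iterate, the residual does not depend on the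
propagation constants one starts from. -/
theorem L0_mu {u : X} (hG : (E.gram M u).det ≠ 0) (μ : Fin r → ℝ) :
    E.L0 (E.mu M u) u = E.L0 μ u - E.projB M u (E.L0 μ u) := by
  rw [projB_apply, L0, L0, coeff_sub_sum E M hG, mu]
  ext ψ
  simp only [_root_.sub_apply, _root_.sum_apply, _root_.smul_apply, Pi.sub_apply, smul_eq_mul,
    sub_mul, Finset.sum_sub_distrib]
  ring

theorem mu_eq_of_solution {u : X} (hG : (E.gram M u).det ≠ 0) {μ : Fin r → ℝ}
    (h : E.L0 μ u = 0) : E.mu M u = μ := by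
  have h1 : E.L00 u = 0 - ∑ j, (-μ) j • E.B j u := by
    rw [L0, sub_eq_zero] at h
    ext ψ
    simp [h]
  have h2 : E.coeff M u 0 = 0 := by
    simp [coeff, ← Pi.zero_def]
  rw [mu, h1, coeff_sub_sum E M hG, h2, zero_sub, neg_neg]

/-- A solution that satisfies the constraints is a fixed point of the method. -/
theorem step_eq_self {u : X} (hG : (E.gram M u).det ≠ 0) {μ : Fin r → ℝ}
    (h : E.L0 μ u = 0) (hQ : ∀ j, E.Q j u = E.C j) (h' dt : ℝ) : E.step M h' dt u = u := by
  simp [step, mu_eq_of_solution E M hG h, h, hQ]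

/-- On the diagonal both terms are negatives of squares (for `h > 0`); symmetry, sign and kernel of
`𝓛_QC` are read off from this form. -/
theorem op_LQC_apply {u : X} (hG : (E.gram M u).det ≠ 0) (h : ℝ) (μ : Fin r → ℝ) (ψ φ : X) :
    M.op (E.LQC M h μ u ψ) φ =
      -((E.L1 μ u φ - E.projB M u (E.L1 μ u φ))
        (M.inv (E.L1 μ u ψ - E.projB M u (E.L1 μ u ψ)))) -
      h * ∑ j, E.dQ j u ψ * E.dQ j u φ := by
  rw [LQC_apply, M.op_inv, ← projB_apply, ← apply_inv_sub_projB E M hG]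
  simp [L1adj_apply]

theorem op_LQC_symm {u : X} (hG : (E.gram M u).det ≠ 0) (h : ℝ) (μ : Fin r → ℝ) (ψ φ : X) :
    M.op (E.LQC M h μ u ψ) φ = M.op ψ (E.LQC M h μ u φ) := by
  rw [M.hermitian ψ, op_LQC_apply E M hG, op_LQC_apply E M hG, M.apply_inv_comm]
  simp only [mul_comm]

theorem op_LQC_self_nonpos {u : X} (hG : (E.gram M u).det ≠ 0) {h : ℝ} (hh : 0 < h)
    (μ : Fin r → ℝ) (ψ : X) : M.op (E.LQC M h μ u ψ) ψ ≤ 0 := by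
  rw [op_LQC_apply E M hG]
  have h1 := M.apply_inv_self_nonneg (E.L1 μ u ψ - E.projB M u (E.L1 μ u ψ))
  have h2 : 0 ≤ ∑ j, E.dQ j u ψ * E.dQ j u ψ := Finset.sum_nonneg fun j _ => mul_self_nonneg _
  have h3 := mul_nonneg hh.le h2
  linarith

theorem eq_projB_of_op_LQC_self {u : X} (hG : (E.gram M u).det ≠ 0) {h : ℝ} (hh : 0 < h)
    {μ : Fin r → ℝ} {ψ : X} (h0 : M.op (E.LQC M h μ u ψ) ψ = 0) :
    E.L1 μ u ψ = E.projB M u (E.L1 μ u ψ) ∧ ∀ j, E.dQ j u ψ = 0 := by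
  rw [op_LQC_apply E M hG] at h0
  have h1 := M.apply_inv_self_nonneg (E.L1 μ u ψ - E.projB M u (E.L1 μ u ψ))
  have h2 : 0 ≤ ∑ j, E.dQ j u ψ * E.dQ j u ψ := Finset.sum_nonneg fun j _ => mul_self_nonneg _
  have h3 := mul_nonneg hh.le h2
  refine ⟨sub_eq_zero.1 (M.eq_zero_of_apply_inv_self (by linarith)), fun j => ?_⟩
  have h4 : ∑ j, E.dQ j u ψ * E.dQ j u ψ = 0 := by
    have : h * ∑ j, E.dQ j u ψ * E.dQ j u ψ = 0 := by linarith
    exact (mul_eq_zero.1 this).resolve_left hh.ne'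
  have := (Finset.sum_eq_zero_iff_of_nonneg fun j _ => mul_self_nonneg _).1 h4 j (Finset.mem_univ j)
  exact mul_self_eq_zero.1 this

section Family

variable {s : ℕ} {U : (Fin r → ℝ) × (Fin s → ℝ) → X} {μ₀ : Fin r → ℝ} {c₀ : Fin s → ℝ}

theorem hasFDerivAt_L0 {u : X} (hL : DifferentiableAt ℝ E.L00 u)
    (hB : ∀ j, DifferentiableAt ℝ (E.B j) u) (μ : Fin r → ℝ) :
    HasFDerivAt (E.L0 μ) (fderiv ℝ E.L00 u - ∑ j, μ j • fderiv ℝ (E.B j) u) u :=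
  hL.hasFDerivAt.sub (HasFDerivAt.fun_sum fun j _ => (hB j).hasFDerivAt.const_smul (μ j))

theorem L1_eq {u : X} (hL : DifferentiableAt ℝ E.L00 u)
    (hB : ∀ j, DifferentiableAt ℝ (E.B j) u) (μ : Fin r → ℝ) :
    E.L1 μ u = fderiv ℝ E.L00 u - ∑ j, μ j • fderiv ℝ (E.B j) u :=
  (E.hasFDerivAt_L0 hL hB μ).fderiv

/-- Differentiate the identity `L₀ (U(μ; c)) = 0` in the direction `(a, b)`. The explicit dependence
on `μ` contributes `-∑ aⱼ Bⱼ`. -/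
theorem L1_fderiv_family (hU : E.IsSolutionFamily U μ₀ c₀)
    (hL : DifferentiableAt ℝ E.L00 (U (μ₀, c₀)))
    (hB : ∀ j, DifferentiableAt ℝ (E.B j) (U (μ₀, c₀))) (a : Fin r → ℝ) (b : Fin s → ℝ) :
    E.L1 μ₀ (U (μ₀, c₀)) (fderiv ℝ U (μ₀, c₀) (a, b)) = ∑ j, a j • E.B j (U (μ₀, c₀)) := by
  have hUd : HasFDerivAt U (fderiv ℝ U (μ₀, c₀)) (μ₀, c₀) :=
    (hU.1.differentiableAt one_ne_zero).hasFDerivAt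
  have hc : ∀ j, HasFDerivAt (fun p : (Fin r → ℝ) × (Fin s → ℝ) => p.1 j)
      ((ContinuousLinearMap.proj j).comp (ContinuousLinearMap.fst ℝ (Fin r → ℝ) (Fin s → ℝ)))
      (μ₀, c₀) := fun j => ((ContinuousLinearMap.proj (R := ℝ) (φ := fun _ : Fin r => ℝ) j).comp
      (ContinuousLinearMap.fst ℝ (Fin r → ℝ) (Fin s → ℝ))).hasFDerivAt
  have h1 := (hL.hasFDerivAt.comp (μ₀, c₀) hUd).sub
    (HasFDerivAt.fun_sum (u := Finset.univ) fun j _ =>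
      (hc j).smul ((hB j).hasFDerivAt.comp (μ₀, c₀) hUd))
  have h2 : HasFDerivAt (fun _ : (Fin r → ℝ) × (Fin s → ℝ) => (0 : StrongDual ℝ X))
      (0 : (Fin r → ℝ) × (Fin s → ℝ) →L[ℝ] StrongDual ℝ X) (μ₀, c₀) :=
    hasFDerivAt_const _ _
  have h3 := h1.unique (h2.congr_of_eventuallyEq hU.2)
  have h4 := congrArg (fun T => T (a, b)) h3
  simp only [_root_.sub_apply, _root_.sum_apply, _root_.add_apply, _root_.smul_apply,
    ContinuousLinearMap.comp_apply, ContinuousLinearMap.smulRight_apply, Finset.sum_add_distrib,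
    ContinuousLinearMap.proj_apply, ContinuousLinearMap.coe_fst', _root_.zero_apply,
    Function.comp_apply] at h4
  rw [E.L1_eq hL hB]
  simp only [_root_.sub_apply, _root_.sum_apply, _root_.smul_apply]
  rw [← sub_eq_zero, ← h4]
  abel

theorem dQdmu_apply (hU : E.IsSolutionFamily U μ₀ c₀)
    (hQ : ∀ j, DifferentiableAt ℝ (E.Q j) (U (μ₀, c₀))) (i j : Fin r) :
    E.dQdmu U μ₀ c₀ i j = E.dQ i (U (μ₀, c₀)) (fderiv ℝ U (μ₀, c₀) (Pi.single j 1, 0)) := by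
  have h := ((hQ i).hasFDerivAt.comp (μ₀, c₀) (hU.1.differentiableAt one_ne_zero).hasFDerivAt).fderiv
  have h' := congrArg (fun T => T ((Pi.single j 1 : Fin r → ℝ), (0 : Fin s → ℝ))) h
  exact h'

theorem dQ_fderiv_family (hU : E.IsSolutionFamily U μ₀ c₀)
    (hQ : ∀ j, DifferentiableAt ℝ (E.Q j) (U (μ₀, c₀))) (i : Fin r) (a : Fin r → ℝ) :
    E.dQ i (U (μ₀, c₀)) (fderiv ℝ U (μ₀, c₀) (a, 0)) = (E.dQdmu U μ₀ c₀ *ᵥ a) i := by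
  have ha : ((a, 0) : (Fin r → ℝ) × (Fin s → ℝ)) = ∑ j, a j • (Pi.single j 1, 0) := by
    refine Prod.ext ?_ ?_
    · ext k
      simp [Prod.fst_sum, Finset.sum_apply, Pi.single_apply]
    · simp [Prod.snd_sum]
  rw [ha, map_sum, map_sum]
  simp only [map_smul]
  simp [Matrix.mulVec, dotProduct, dQdmu_apply E hU hQ, mul_comm]

/-- The columns of `B` are linearly independent at the solitary wave. -/
theorem linearIndependent_B (hU : E.IsSolutionFamily U μ₀ c₀)
    (hL : DifferentiableAt ℝ E.L00 (U (μ₀, c₀)))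
    (hB : ∀ j, DifferentiableAt ℝ (E.B j) (U (μ₀, c₀)))
    (hQ : ∀ j, DifferentiableAt ℝ (E.Q j) (U (μ₀, c₀)))
    (horth : ∀ j, ∀ ψ ∈ (E.L1 μ₀ (U (μ₀, c₀))).ker, E.dQ j (U (μ₀, c₀)) ψ = 0)
    (hdet : (E.dQdmu U μ₀ c₀).det ≠ 0) :
    LinearIndependent ℝ fun j => E.B j (U (μ₀, c₀)) := by
  rw [Fintype.linearIndependent_iff]
  intro a ha
  have h1 : fderiv ℝ U (μ₀, c₀) (a, 0) ∈ (E.L1 μ₀ (U (μ₀, c₀))).ker :=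
    (E.L1_fderiv_family hU hL hB a 0).trans ha
  have h2 : E.dQdmu U μ₀ c₀ *ᵥ a = 0 := by
    ext i
    rw [← E.dQ_fderiv_family hU hQ, horth i _ h1, Pi.zero_apply]
  exact congrFun (Matrix.eq_zero_of_mulVec_eq_zero hdet h2)

/-- A vanishing quadratic form gives `L₁ ψ = ∑ aⱼ Bⱼ` and `δQ ψ = 0`. Subtracting the derivative of
`U` along `a` lands in `ker L₁`, where `δQ` vanishes by orthogonality, so `(∂Q/∂μ) a = 0` and `a =
0`. -/
theorem ker_LQC (hU : E.IsSolutionFamily U μ₀ c₀)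
    (hL : DifferentiableAt ℝ E.L00 (U (μ₀, c₀)))
    (hB : ∀ j, DifferentiableAt ℝ (E.B j) (U (μ₀, c₀)))
    (hQ : ∀ j, DifferentiableAt ℝ (E.Q j) (U (μ₀, c₀)))
    (horth : ∀ j, ∀ ψ ∈ (E.L1 μ₀ (U (μ₀, c₀))).ker, E.dQ j (U (μ₀, c₀)) ψ = 0)
    (hdet : (E.dQdmu U μ₀ c₀).det ≠ 0) {h : ℝ} (hh : 0 < h) :
    (E.LQC M h μ₀ (U (μ₀, c₀))).ker = (E.L1 μ₀ (U (μ₀, c₀))).ker := by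
  have hG := E.gram_det_ne_zero M (E.linearIndependent_B hU hL hB hQ horth hdet)
  ext ψ
  constructor
  · intro hψ
    have h0 : M.op (E.LQC M h μ₀ (U (μ₀, c₀)) ψ) ψ = 0 := by
      have : E.LQC M h μ₀ (U (μ₀, c₀)) ψ = 0 := hψ
      simp [this]
    obtain ⟨h1, h2⟩ := E.eq_projB_of_op_LQC_self M hG hh h0
    rw [projB_apply] at h1
    set a := E.coeff M (U (μ₀, c₀)) (E.L1 μ₀ (U (μ₀, c₀)) ψ)
    have h3 := E.L1_fderiv_family hU hL hB a 0
    have h4 : ψ - fderiv ℝ U (μ₀, c₀) (a, 0) ∈ (E.L1 μ₀ (U (μ₀, c₀))).ker := by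
      have : E.L1 μ₀ (U (μ₀, c₀)) (ψ - fderiv ℝ U (μ₀, c₀) (a, 0)) = 0 := by
        rw [map_sub, h3, ← h1, sub_self]
      exact this
    have h5 : E.dQdmu U μ₀ c₀ *ᵥ a = 0 := by
      ext i
      have h6 := horth i _ h4
      rw [map_sub, h2, zero_sub, neg_eq_zero] at h6
      rw [← E.dQ_fderiv_family hU hQ, h6, Pi.zero_apply]
    have h7 : a = 0 := Matrix.eq_zero_of_mulVec_eq_zero hdet h5
    have h8 : E.L1 μ₀ (U (μ₀, c₀)) ψ = 0 := by rw [h1, h7]; simp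
    exact h8
  · intro hψ
    have h1 : E.L1 μ₀ (U (μ₀, c₀)) ψ = 0 := hψ
    have h2 : E.LQC M h μ₀ (U (μ₀, c₀)) ψ = 0 := by
      rw [LQC_apply, ← projB_apply]
      simp [h1, horth _ _ hψ]
    exact h2

end Family

end ConstrainedEquation

/-! ### Quadratic remainders and smoothness of matrix inverses -/

section Calculus

variable {E G W : Type*} [NormedAddCommGroup E] [NormedSpace ℝ E] [NormedAddCommGroup G]
  [NormedSpace ℝ G] [NormedAddCommGroup W] [NormedSpace ℝ W]

/-- Mean value inequality on the closed ball of radius `‖x - z‖`, where the derivative differs from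
its value at `z` by at most `C ‖x - z‖`. -/
theorem isBigO_sub_fderiv_of_contDiffAt {g : E → G} {z : E} (hg : ContDiffAt ℝ 2 g z) :
    (fun x => g x - g z - fderiv ℝ g z (x - z)) =O[𝓝 z] fun x => ‖x - z‖ ^ 2 := by
  have h1 : ContDiffAt ℝ 1 (fderiv ℝ g) z := hg.fderiv_right (by norm_num)
  obtain ⟨C, hC⟩ := (h1.differentiableAt one_ne_zero).isBigO_sub.bound
  have h2 : ∀ᶠ x in 𝓝 z, DifferentiableAt ℝ g x :=
    (hg.eventually (by simp)).mono fun x hx => hx.differentiableAt two_ne_zero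
  obtain ⟨ρ, hρ, hb⟩ := Metric.eventually_nhds_iff_ball.1 (hC.and h2)
  refine Asymptotics.IsBigO.of_bound C ?_
  filter_upwards [Metric.ball_mem_nhds z hρ] with x hx
  have hsub : Metric.closedBall z ‖x - z‖ ⊆ Metric.ball z ρ :=
    Metric.closedBall_subset_ball (mem_ball_iff_norm.1 hx)
  -- The constant from `IsBigO` carries no sign; a negative one forces `x = z`.
  rcases lt_or_ge C 0 with hC0 | hC0
  · have h3 := (hb x hx).1
    have h4 : ‖x - z‖ = 0 := by
      have := norm_nonneg (x - z)
      have := norm_nonneg (fderiv ℝ g x - fderiv ℝ g z)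
      nlinarith
    rw [norm_sub_eq_zero_iff] at h4
    simp [h4]
  have h3 := (convex_closedBall z ‖x - z‖).norm_image_sub_le_of_norm_hasFDerivWithin_le'
    (f := g) (f' := fderiv ℝ g) (φ := fderiv ℝ g z) (C := C * ‖x - z‖) (x := z) (y := x)
    (fun y hy => ((hb y (hsub hy)).2.hasFDerivAt).hasFDerivWithinAt)
    (fun y hy => ((hb y (hsub hy)).1).trans
      (mul_le_mul_of_nonneg_left (mem_closedBall_iff_norm.1 hy) hC0))
    (Metric.mem_closedBall_self (norm_nonneg _)) (mem_closedBall_iff_norm.2 le_rfl)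
  rw [Real.norm_of_nonneg (by positivity), pow_two, ← mul_assoc]
  exact h3

/-- A product whose second factor vanishes at `z` differs from its linearization by a quadratic
term, even if the first factor is only differentiable. -/
theorem isBigO_clm_apply_sub {f : E → G →L[ℝ] W} {g : E → G} {z : E}
    (hf : DifferentiableAt ℝ f z) (hg : ContDiffAt ℝ 2 g z) (hgz : g z = 0) :
    (fun x => f x (g x) - f z (fderiv ℝ g z (x - z))) =O[𝓝 z] fun x => ‖x - z‖ ^ 2 := by
  have h1 := isBigO_sub_fderiv_of_contDiffAt hg
  have h2 := (hg.differentiableAt two_ne_zero).isBigO_sub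
  simp only [hgz, sub_zero] at h1 h2
  have h3 : (fun x => (f x - f z) (g x)) =O[𝓝 z] fun x => ‖x - z‖ ^ 2 := by
    have h4 : (fun x => (f x - f z) (g x)) =O[𝓝 z] fun x => ‖f x - f z‖ * ‖g x‖ :=
      Asymptotics.IsBigO.of_bound 1 (Eventually.of_forall fun x => by
        rw [one_mul, Real.norm_of_nonneg (by positivity)]
        exact (f x - f z).le_opNorm _)
    refine h4.trans ?_
    simp only [pow_two]
    exact hf.isBigO_sub.norm_norm.mul h2.norm_norm
  have h5 := (((f z).isBigO_comp _ (𝓝 z)).trans h1).add h3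
  refine h5.congr_left fun x => ?_
  simp only [_root_.sub_apply, map_sub]
  abel

/-- `C¹` regularity supplies strictness; the quadratic bound identifies the derivative. -/
theorem hasStrictFDerivAt_of_isBigO {F : E → G} {S : E →L[ℝ] G} {z : E}
    (hF : ContDiffAt ℝ 1 F z)
    (h : (fun x => F x - F z - S (x - z)) =O[𝓝 z] fun x => ‖x - z‖ ^ 2) :
    HasStrictFDerivAt F S z := by
  refine hF.hasStrictFDerivAt' (HasFDerivAt.of_isLittleO (h.trans_isLittleO ?_)) one_ne_zero
  have h1 : (fun x : E => ‖x - z‖ ^ 2) =o[𝓝 z] fun x => ‖x - z‖ := by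
    have h2 : Tendsto (fun x : E => ‖x - z‖) (𝓝 z) (𝓝 0) := by
      have : ContinuousAt (fun x : E => ‖x - z‖) z := by fun_prop
      simpa [ContinuousAt] using this
    have h3 := (Asymptotics.isLittleO_pow_id (𝕜 := ℝ) one_lt_two).comp_tendsto h2
    exact h3
  exact h1.of_norm_right

theorem contDiffAt_matrix_inv {n : WithTop ℕ∞} {r : ℕ} {A : E → Matrix (Fin r) (Fin r) ℝ} {z : E}
    (hA : ∀ i j, ContDiffAt ℝ n (fun x => A x i j) z) (hz : (A z).det ≠ 0) (i j : Fin r) :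
    ContDiffAt ℝ n (fun x => (A x)⁻¹ i j) z := by
  have hdet : ∀ {B : E → Matrix (Fin r) (Fin r) ℝ},
      (∀ i j, ContDiffAt ℝ n (fun x => B x i j) z) → ContDiffAt ℝ n (fun x => (B x).det) z := by
    intro B hB
    simp only [Matrix.det_apply, Units.smul_def, zsmul_eq_mul]
    exact ContDiffAt.sum fun σ _ => contDiffAt_const.mul (contDiffAt_prod fun k _ => hB _ _)
  have hadj : ContDiffAt ℝ n (fun x => (A x).adjugate i j) z := by
    simp only [Matrix.adjugate_apply]
    refine hdet fun k m => ?_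
    rcases eq_or_ne k j with rfl | hk
    · simpa using contDiffAt_const
    · simpa [Matrix.updateRow_ne hk] using hA k m
  have h : (fun x => (A x)⁻¹ i j) = fun x => (A x).det⁻¹ * (A x).adjugate i j := by
    ext x
    rw [Matrix.inv_def, Ring.inverse_eq_inv', Matrix.smul_apply, smul_eq_mul]
  rw [h]
  exact ((hdet hA).inv hz).mul hadj

theorem contDiffAt_smul {n : WithTop ℕ∞} {c : E → ℝ} {f : E → W} {z : E}
    (hc : ContDiffAt ℝ n c z) (hf : ContDiffAt ℝ n f z) : ContDiffAt ℝ n (fun x => c x • f x) z :=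
  hc.smul hf

theorem contDiffAt_flip {n : WithTop ℕ∞} {f : E → G →L[ℝ] E →L[ℝ] W} {z : E}
    (hf : ContDiffAt ℝ n f z) : ContDiffAt ℝ n (fun x => (f x).flip) z :=
  ContDiffAt.comp (g := fun T : G →L[ℝ] E →L[ℝ] W => T.flip) z
    (IsBoundedLinearMap.contDiff ⟨⟨fun _ _ => rfl, fun _ _ => rfl⟩, 1, one_pos, fun T => by
      rw [one_mul, ContinuousLinearMap.opNorm_flip]⟩).contDiffAt hf

end Calculus

/-! ### Regularity and linearization of the step -/

namespace ConstrainedEquation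

variable {X : Type*} [NormedAddCommGroup X] [NormedSpace ℝ X]
variable {r : ℕ} (E : ConstrainedEquation X r) (M : AccelerationOperator X)

section Smoothness

variable {u : X}

theorem contDiffAt_gram (hB : ∀ j, ContDiffAt ℝ 2 (E.B j) u) (i j : Fin r) :
    ContDiffAt ℝ 2 (fun x => E.gram M x i j) u := by
  simp only [gram, Matrix.of_apply]
  exact (hB i).clm_apply (M.inv.contDiff.contDiffAt.comp u (hB j))

theorem eventually_gram_det_ne_zero (hB : ∀ j, ContDiffAt ℝ 2 (E.B j) u)
    (hG : (E.gram M u).det ≠ 0) : ∀ᶠ x in 𝓝 u, (E.gram M x).det ≠ 0 := by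
  have h : ContinuousAt (fun x => E.gram M x) u :=
    continuousAt_pi.2 fun i => continuousAt_pi.2 fun j => (E.contDiffAt_gram M hB i j).continuousAt
  have h' : ContinuousAt (fun x => (E.gram M x).det) u :=
    (continuous_id.matrix_det.continuousAt).comp h
  exact h'.eventually_ne hG

theorem contDiffAt_projB (hB : ∀ j, ContDiffAt ℝ 2 (E.B j) u) (hG : (E.gram M u).det ≠ 0) :
    ContDiffAt ℝ 2 (E.projB M) u := by
  refine ContDiffAt.sum fun i _ => ContDiffAt.sum fun j _ => ?_
  exact contDiffAt_smul (contDiffAt_matrix_inv (E.contDiffAt_gram M hB) hG i j)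
    (((hB j).clm_comp contDiffAt_const).smulRight (hB i))

theorem contDiffAt_mu (hL : ContDiffAt ℝ 2 E.L00 u) (hB : ∀ j, ContDiffAt ℝ 2 (E.B j) u)
    (hG : (E.gram M u).det ≠ 0) (i : Fin r) : ContDiffAt ℝ 2 (fun x => E.mu M x i) u := by
  simp only [mu, coeff, Matrix.mulVec, dotProduct]
  refine ContDiffAt.sum fun j _ => (contDiffAt_matrix_inv (E.contDiffAt_gram M hB) hG i j).mul ?_
  exact (hB j).clm_apply (M.inv.contDiff.contDiffAt.comp u hL)

theorem contDiffAt_L1_mu (hL : ContDiffAt ℝ 2 E.L00 u) (hB : ∀ j, ContDiffAt ℝ 2 (E.B j) u)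
    (hG : (E.gram M u).det ≠ 0) : ContDiffAt ℝ 1 (fun x => E.L1 (E.mu M x) x) u := by
  have hd : ∀ {g : X → StrongDual ℝ X},
      ContDiffAt ℝ 2 g u → ∀ᶠ x in 𝓝 u, DifferentiableAt ℝ g x := fun hg =>
    (hg.eventually (by simp)).mono fun x hx => hx.differentiableAt two_ne_zero
  have h : ContDiffAt ℝ 1
      (fun x => fderiv ℝ E.L00 x - ∑ j, E.mu M x j • fderiv ℝ (E.B j) x) u :=
    (hL.fderiv_right (by norm_num)).sub (ContDiffAt.sum fun j _ =>
      contDiffAt_smul ((E.contDiffAt_mu M hL hB hG j).of_le one_le_two)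
        ((hB j).fderiv_right (by norm_num)))
  refine h.congr_of_eventuallyEq ?_
  filter_upwards [hd hL, eventually_all.2 fun j => hd (hB j)] with x h1 h2
  exact E.L1_eq h1 h2 _

theorem contDiffAt_L0 (hL : ContDiffAt ℝ 2 E.L00 u) (hB : ∀ j, ContDiffAt ℝ 2 (E.B j) u)
    (μ : Fin r → ℝ) : ContDiffAt ℝ 2 (E.L0 μ) u :=
  hL.sub (ContDiffAt.sum fun j _ => contDiffAt_smul contDiffAt_const (hB j))

/-- The operator `L₁† M⁻¹ (1 - B ⟨B, M⁻¹ B⟩⁻¹ ⟨B, M⁻¹ ·⟩)` at an iterate. -/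
noncomputable def residualOp (x : X) : StrongDual ℝ X →L[ℝ] StrongDual ℝ X :=
  (E.L1adj (E.mu M x) x).comp
    (M.inv.comp (ContinuousLinearMap.id ℝ (StrongDual ℝ X) - E.projB M x))

/-- The operator `c ↦ c δQⱼ/δu` at an iterate. -/
noncomputable def constraintOp (j : Fin r) (x : X) : ℝ →L[ℝ] StrongDual ℝ X :=
  (ContinuousLinearMap.id ℝ ℝ).smulRight (E.dQ j x)

/-- The method in terms of products whose second factors vanish at the solitary wave. -/
theorem step_eq {x : X} (hG : (E.gram M x).det ≠ 0) (μ : Fin r → ℝ) (h dt : ℝ) :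
    E.step M h dt x = x - dt • M.inv (E.residualOp M x (E.L0 μ x) +
      h • ∑ j, E.constraintOp j x (E.Q j x - E.C j)) := by
  rw [step, E.L0_mu M hG μ]
  rfl

theorem contDiffAt_residualOp (hL : ContDiffAt ℝ 2 E.L00 u)
    (hB : ∀ j, ContDiffAt ℝ 2 (E.B j) u) (hG : (E.gram M u).det ≠ 0) :
    ContDiffAt ℝ 1 (E.residualOp M) u :=
  (contDiffAt_flip (E.contDiffAt_L1_mu M hL hB hG)).clm_comp (contDiffAt_const.clm_comp
    (contDiffAt_const.sub ((E.contDiffAt_projB M hB hG).of_le one_le_two)))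

theorem contDiffAt_constraintOp (hQ : ∀ j, ContDiffAt ℝ 2 (E.Q j) u) (j : Fin r) :
    ContDiffAt ℝ 1 (E.constraintOp j) u :=
  contDiffAt_const.smulRight ((hQ j).fderiv_right (by norm_num))

theorem contDiffAt_step (hL : ContDiffAt ℝ 2 E.L00 u) (hB : ∀ j, ContDiffAt ℝ 2 (E.B j) u)
    (hQ : ∀ j, ContDiffAt ℝ 2 (E.Q j) u) (hG : (E.gram M u).det ≠ 0) (h dt : ℝ) :
    ContDiffAt ℝ 1 (E.step M h dt) u := by
  -- The `μ` in `step_eq` is free, so `0` serves here.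
  have h1 : ContDiffAt ℝ 1 (fun x => E.residualOp M x (E.L0 0 x)) u :=
    (E.contDiffAt_residualOp M hL hB hG).clm_apply ((E.contDiffAt_L0 hL hB 0).of_le one_le_two)
  have h2 : ContDiffAt ℝ 1 (fun x => ∑ j, E.constraintOp j x (E.Q j x - E.C j)) u :=
    ContDiffAt.sum fun j _ => (E.contDiffAt_constraintOp hQ j).clm_apply
      (((hQ j).of_le one_le_two).sub contDiffAt_const)
  have h3 : ContDiffAt ℝ 1 (fun x => x - dt • M.inv (E.residualOp M x (E.L0 0 x) +
      h • ∑ j, E.constraintOp j x (E.Q j x - E.C j))) u :=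
    contDiffAt_id.sub (contDiffAt_smul contDiffAt_const
      (M.inv.contDiff.contDiffAt.comp u (h1.add (contDiffAt_smul contDiffAt_const h2))))
  refine h3.congr_of_eventuallyEq ?_
  filter_upwards [E.eventually_gram_det_ne_zero M hB hG] with x hx
  exact E.step_eq M hx 0 h dt

/-- `L₀` at `μ₀` and `Qⱼ - Cⱼ` vanish at `u`. So the variation of `L₁†`, of `μ(u)` and of `δQⱼ/δu`
enters only at second order, and differentiability of these operator factors is enough. -/
theorem isBigO_step_sub (hL : ContDiffAt ℝ 2 E.L00 u) (hB : ∀ j, ContDiffAt ℝ 2 (E.B j) u)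
    (hQ : ∀ j, ContDiffAt ℝ 2 (E.Q j) u) (hG : (E.gram M u).det ≠ 0) {μ₀ : Fin r → ℝ}
    (h0 : E.L0 μ₀ u = 0) (hC : ∀ j, E.Q j u = E.C j) (h dt : ℝ) :
    (fun x => E.step M h dt x - E.step M h dt u - (1 + dt • E.LQC M h μ₀ u) (x - u))
      =O[𝓝 u] fun x => ‖x - u‖ ^ 2 := by
  have h1 := isBigO_clm_apply_sub
    ((E.contDiffAt_residualOp M hL hB hG).differentiableAt one_ne_zero)
    (E.contDiffAt_L0 hL hB μ₀) h0
  have h2 : ∀ j, (fun x => E.constraintOp j x (E.Q j x - E.C j) -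
      E.constraintOp j u (E.dQ j u (x - u))) =O[𝓝 u] fun x => ‖x - u‖ ^ 2 := fun j => by
    have h3 := isBigO_clm_apply_sub
      ((E.contDiffAt_constraintOp hQ j).differentiableAt one_ne_zero)
      ((hQ j).sub (contDiffAt_const (c := E.C j))) (by simp [hC])
    rw [show fderiv ℝ (fun x => E.Q j x - E.C j) u = E.dQ j u from fderiv_sub_const _] at h3
    exact h3
  have h3 : (fun x => ∑ j, (E.constraintOp j x (E.Q j x - E.C j) -
      E.constraintOp j u (E.dQ j u (x - u)))) =O[𝓝 u] fun x => ‖x - u‖ ^ 2 :=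
    Asymptotics.IsBigO.fun_sum fun j _ => h2 j
  have h4 := ((-(dt • M.inv)).isBigO_comp _ (𝓝 u)).trans (h1.add (h3.const_smul_left h))
  refine h4.congr' ?_ EventuallyEq.rfl
  filter_upwards [E.eventually_gram_det_ne_zero M hB hG] with x hx
  have h5 : E.LQC M h μ₀ u (x - u) = -M.inv (E.residualOp M u (E.L1 μ₀ u (x - u)) +
      h • ∑ j, E.constraintOp j u (E.dQ j u (x - u))) := by
    rw [LQC_apply, ← projB_apply, residualOp, E.mu_eq_of_solution M hG h0]
    have h6 : ∀ a b : StrongDual ℝ X, -a - b = -(a + b) := fun a b => by abel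
    exact (congrArg M.inv (h6 _ _)).trans (map_neg M.inv _)
  rw [E.step_eq_self M hG h0 hC, E.step_eq M hx μ₀, _root_.add_apply, one_apply_eq_self,
    _root_.smul_apply, h5, Pi.smul_apply, Finset.sum_sub_distrib, ← L1]
  have h6 : ∀ a b c d : StrongDual ℝ X,
      (-(dt • M.inv)) (a - b + h • (c - d)) =
        x - dt • M.inv (a + h • c) - u - (x - u + dt • -M.inv (b + h • d)) := fun a b c d => by
    rw [show a - b + h • (c - d) = (a + h • c) - (b + h • d) by module, _root_.neg_apply,
      _root_.smul_apply, map_sub]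
    module
  exact h6 _ _ _ _

theorem hasStrictFDerivAt_step (hL : ContDiffAt ℝ 2 E.L00 u)
    (hB : ∀ j, ContDiffAt ℝ 2 (E.B j) u)
    (hQ : ∀ j, ContDiffAt ℝ 2 (E.Q j) u) (hG : (E.gram M u).det ≠ 0) {μ₀ : Fin r → ℝ}
    (h0 : E.L0 μ₀ u = 0) (hC : ∀ j, E.Q j u = E.C j) (h dt : ℝ) :
    HasStrictFDerivAt (E.step M h dt) (1 + dt • E.LQC M h μ₀ u) u :=
  hasStrictFDerivAt_of_isBigO (E.contDiffAt_step M hL hB hQ hG h dt)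
    (E.isBigO_step_sub M hL hB hQ hG h0 hC h dt)

end Smoothness

end ConstrainedEquation

/-! ### The Hilbert structure given by `M` -/

section EnergySpace

variable {X : Type*} [NormedAddCommGroup X] [NormedSpace ℝ X]

/-- The space `X` with the inner product `⟨M φ, ψ⟩`. -/
def EnergySpace (_M : AccelerationOperator X) : Type _ := X

namespace EnergySpace

variable (M : AccelerationOperator X)

instance : AddCommGroup (EnergySpace M) := inferInstanceAs (AddCommGroup X)

instance : Module ℝ (EnergySpace M) := inferInstanceAs (Module ℝ X)

/-- The identity map onto the energy space. -/
def ofLinear : X ≃ₗ[ℝ] EnergySpace M := LinearEquiv.refl ℝ X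

/-- The inner product `⟨M φ, ψ⟩`. -/
@[reducible] noncomputable def core : InnerProductSpace.Core ℝ (EnergySpace M) where
  inner φ ψ := M.op ((ofLinear M).symm φ) ((ofLinear M).symm ψ)
  conj_inner_symm φ ψ := M.hermitian _ _
  re_inner_nonneg φ := by
    rcases eq_or_ne ((ofLinear M).symm φ) 0 with h | h
    · simp [h]
    · exact (M.posDef _ h).le
  add_left φ ψ χ := by simp
  smul_left φ ψ c := by simp
  definite φ h := by
    by_contra hφ
    exact (M.posDef _ ((LinearEquiv.map_ne_zero_iff _).2 hφ)).ne' h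

noncomputable instance : NormedAddCommGroup (EnergySpace M) := (core M).toNormedAddCommGroup

noncomputable instance : InnerProductSpace ℝ (EnergySpace M) :=
  InnerProductSpace.ofCore (core M).toCore

theorem inner_ofLinear (φ ψ : X) : inner ℝ (ofLinear M φ) (ofLinear M ψ) = M.op φ ψ := rfl

theorem norm_ofLinear_sq (φ : X) : ‖ofLinear M φ‖ ^ 2 = M.op φ φ := by
  rw [← real_inner_self_eq_norm_sq, inner_ofLinear]

theorem norm_ofLinear_le (φ : X) :
    ‖ofLinear M φ‖ ≤ √‖(M.op : X →L[ℝ] StrongDual ℝ X)‖ * ‖φ‖ := by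
  refine le_of_sq_le_sq ?_ (by positivity)
  rw [norm_ofLinear_sq, mul_pow, Real.sq_sqrt (by positivity)]
  have h1 := (M.op φ).le_opNorm φ
  have h2 := (M.op : X →L[ℝ] StrongDual ℝ X).le_opNorm φ
  have h3 : ‖M.op φ‖ * ‖φ‖ ≤ ‖(M.op : X →L[ℝ] StrongDual ℝ X)‖ * ‖φ‖ * ‖φ‖ := by
    gcongr
    exact h2
  have h4 := le_abs_self (M.op φ φ)
  rw [← Real.norm_eq_abs] at h4
  linarith

/-- Cauchy–Schwarz for the energy inner product bounds the dual norm of `M φ` by the energy norm of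
`φ`; boundedness of `M⁻¹` then returns to `‖φ‖`. Invertibility of `M`, not positivity alone, gives
the equivalence. -/
theorem norm_le_norm_ofLinear (φ : X) :
    ‖φ‖ ≤ ‖M.inv‖ * √‖(M.op : X →L[ℝ] StrongDual ℝ X)‖ * ‖ofLinear M φ‖ := by
  have h1 : ‖M.op φ‖ ≤ √‖(M.op : X →L[ℝ] StrongDual ℝ X)‖ * ‖ofLinear M φ‖ := by
    refine ContinuousLinearMap.opNorm_le_bound _ (by positivity) fun ψ => ?_
    rw [← inner_ofLinear]
    refine (norm_inner_le_norm _ _).trans ?_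
    calc _ ≤ ‖ofLinear M φ‖ * (√‖(M.op : X →L[ℝ] StrongDual ℝ X)‖ * ‖ψ‖) := by
          gcongr
          exact norm_ofLinear_le M ψ
      _ = _ := by ring
  calc ‖φ‖ = ‖M.inv (M.op φ)‖ := by rw [M.inv_op]
    _ ≤ ‖M.inv‖ * ‖M.op φ‖ := M.inv.le_opNorm _
    _ ≤ ‖M.inv‖ * (√‖(M.op : X →L[ℝ] StrongDual ℝ X)‖ * ‖ofLinear M φ‖) := by gcongr
    _ = _ := by ring

/-- The norm of the energy space is equivalent to the norm of `X`. -/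
noncomputable def equiv : X ≃L[ℝ] EnergySpace M where
  toLinearEquiv := ofLinear M
  continuous_toFun := AddMonoidHomClass.continuous_of_bound (ofLinear M) _ (norm_ofLinear_le M)
  continuous_invFun := AddMonoidHomClass.continuous_of_bound (ofLinear M).symm _
    fun φ => norm_le_norm_ofLinear M ((ofLinear M).symm φ)

theorem inner_equiv (φ ψ : X) : inner ℝ (equiv M φ) (equiv M ψ) = M.op φ ψ := rfl

instance [CompleteSpace X] : CompleteSpace (EnergySpace M) :=
  (completeSpace_congr (e := (equiv M).toEquiv) (equiv M).isUniformEmbedding).1 inferInstance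

end EnergySpace

end EnergySpace

/-! ### Solutions with prescribed `Q` below nearby points -/

section Family

variable {X : Type*} [NormedAddCommGroup X] [NormedSpace ℝ X] {r s : ℕ}
  (E : ConstrainedEquation X r)

/-- Every point near the solitary wave lies over a member of the solution family that satisfies the
constraints. -/
theorem ConstrainedEquation.eventually_exists_solution_below {H : Type*} [NormedAddCommGroup H]
    [InnerProductSpace ℝ H] (e : X ≃L[ℝ] H)
    {U : (Fin r → ℝ) × (Fin s → ℝ) → X} {μ₀ : Fin r → ℝ} {c₀ : Fin s → ℝ}
    (hU : E.IsSolutionFamily U μ₀ c₀) (hC : ∀ j, E.Q j (U (μ₀, c₀)) = E.C j)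
    (hQ : ∀ j, ContDiffAt ℝ 2 (E.Q j) (U (μ₀, c₀)))
    (hker : E.KernelIsInvarianceModes U μ₀ c₀)
    (horth : ∀ j, ∀ ψ ∈ (E.L1 μ₀ (U (μ₀, c₀))).ker, E.dQ j (U (μ₀, c₀)) ψ = 0)
    (hdet : (E.dQdmu U μ₀ c₀).det ≠ 0) {K : Submodule ℝ H} [CompleteSpace K]
    (hK : ∀ k ∈ K, e.symm k ∈ (E.L1 μ₀ (U (μ₀, c₀))).ker)
    {N : Set ((Fin r → ℝ) × (Fin s → ℝ))} (hN : N ∈ 𝓝 (μ₀, c₀)) :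
    ∀ᶠ x in 𝓝 (e (U (μ₀, c₀))), ∃ p ∈ N,
      (E.L0 p.1 (U p) = 0 ∧ ∀ j, E.Q j (U p) = E.C j) ∧ x - e (U p) ∈ Kᗮ := by
  set P : H →L[ℝ] K := K.orthogonalProjectionOnto
  set U' := fderiv ℝ U (μ₀, c₀)
  have hUs : HasStrictFDerivAt U U' (μ₀, c₀) := hU.1.hasStrictFDerivAt one_ne_zero
  have h1 : HasStrictFDerivAt (fun p => (P (e (U p)), fun j => E.Q j (U p)))
      (((P.comp (e : X →L[ℝ] H)).comp U').prod
        (ContinuousLinearMap.pi fun j => (E.dQ j (U (μ₀, c₀))).comp U')) (μ₀, c₀) :=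
    ((P.comp (e : X →L[ℝ] H)).hasStrictFDerivAt.comp (μ₀, c₀) hUs).prodMk
      (hasStrictFDerivAt_pi.2 fun j => ((hQ j).hasStrictFDerivAt two_ne_zero).comp (μ₀, c₀) hUs)
  have hQd : ∀ j, DifferentiableAt ℝ (E.Q j) (U (μ₀, c₀)) := fun j =>
    (hQ j).differentiableAt two_ne_zero
  have hspan : ∀ ψ ∈ (E.L1 μ₀ (U (μ₀, c₀))).ker, ∃ b : Fin s → ℝ, U' (0, b) = ψ := fun ψ hψ => by
    rw [hker, Submodule.mem_span_range_iff_exists_fun] at hψ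
    obtain ⟨b, hb⟩ := hψ
    refine ⟨b, ?_⟩
    have h : ((0, b) : (Fin r → ℝ) × (Fin s → ℝ)) = ∑ j, b j • (0, Pi.single j 1) := by
      refine Prod.ext ?_ ?_
      · simp [Prod.fst_sum]
      · ext k
        simp [Prod.snd_sum, Finset.sum_apply, Pi.single_apply]
    rw [h, map_sum, ← hb]
    exact Finset.sum_congr rfl fun j _ => map_smul U' _ _
  -- Surjectivity is triangular: `a` is solved from `∂Q/∂μ` to match `q`, then `b` corrects the
  -- `K`-component, which leaves `q` alone because `δQ` vanishes on `ker L₁`.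
  have h2 : (((P.comp (e : X →L[ℝ] H)).comp U').prod
      (ContinuousLinearMap.pi fun j => (E.dQ j (U (μ₀, c₀))).comp U')).range = ⊤ := by
    rw [LinearMap.range_eq_top]
    rintro ⟨k, q⟩
    set a := (E.dQdmu U μ₀ c₀)⁻¹ *ᵥ q
    have ha : E.dQdmu U μ₀ c₀ *ᵥ a = q := by
      rw [Matrix.mulVec_mulVec, Matrix.mul_nonsing_inv _ (isUnit_iff_ne_zero.2 hdet),
        Matrix.one_mulVec]
    set k' : K := k - P (e (U' (a, 0)))
    have hk' := hK k' k'.2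
    obtain ⟨b, hb⟩ := hspan _ hk'
    have hab : U' (a, b) = U' (a, 0) + e.symm k' := by
      rw [← hb, ← map_add, Prod.mk_add_mk, add_zero, zero_add]
    refine ⟨(a, b), Prod.ext ?_ ?_⟩
    · have : P (e (U' (a, b))) = k := by
        rw [hab, map_add, map_add, e.apply_symm_apply,
          K.orthogonalProjectionOnto_mem_subspace_eq_self k']
        simp [k']
      exact this
    · ext i
      have : E.dQ i (U (μ₀, c₀)) (U' (a, b)) = q i := by
        rw [hab, map_add, horth i _ hk', add_zero, E.dQ_fderiv_family hU hQd, ha]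
      exact this
  -- A strictly differentiable map with surjective derivative is open at the point, so every value
  -- `(P x, C)` with `x` near the wave is attained by some `p ∈ N`.
  have h3 := h1.map_nhds_eq_of_surj h2
  have hN' : N ∩ {p | E.L0 p.1 (U p) = 0} ∈ 𝓝 (μ₀, c₀) := inter_mem hN hU.2
  have h4 := image_mem_map (m := fun p => (P (e (U p)), fun j => E.Q j (U p))) hN'
  rw [h3] at h4
  have h5 : ContinuousAt (fun x => (P x, E.C)) (e (U (μ₀, c₀))) := by fun_prop
  have h6 : (P (e (U (μ₀, c₀))), fun j => E.Q j (U (μ₀, c₀))) = (P (e (U (μ₀, c₀))), E.C) := by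
    simp [hC]
  rw [h6] at h4
  filter_upwards [h5 h4] with x hx
  obtain ⟨p, ⟨hpN, hp0⟩, hp⟩ := hx
  rw [Prod.mk.injEq] at hp
  refine ⟨p, hpN, ⟨hp0, congrFun hp.2⟩, ?_⟩
  rw [← K.orthogonalProjectionOnto_eq_zero_iff, map_sub, sub_eq_zero]
  exact hp.1.symm

end Family

/-! ### From the spectrum of `A` to contraction and expansion of `1 + Δt A` -/

section Iteration

variable {H : Type*} [NormedAddCommGroup H] [InnerProductSpace ℝ H]

local notation "⟪" x ", " y "⟫" => inner ℝ x y

/-- With `T² ≤ c T`, expanding the square gives `‖T y - l y‖² ≤ l² ‖y‖² - (2 l - c) ⟪T y, y⟫`. It is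
used with `l = 1` for contraction off the kernel and with `l > 1` for dominance of an eigenspace. -/
theorem exists_norm_sub_smul_le {T : H →L[ℝ] H} (hT : ∀ x y, ⟪T x, y⟫ = ⟪x, T y⟫)
    (h0 : ∀ x, 0 ≤ ⟪T x, x⟫) {c l δ : ℝ} (hc : ∀ x, ⟪T x, x⟫ ≤ c * ‖x‖ ^ 2) (hcl : c < 2 * l)
    (hl : 0 < l) (hδ : 0 < δ) {K : Submodule ℝ H} (hK : ∀ y ∈ K, δ * ‖y‖ ^ 2 ≤ ⟪T y, y⟫) :
    ∃ ρ, 0 ≤ ρ ∧ ρ < l ∧ ∀ y ∈ K, ‖T y - l • y‖ ≤ ρ * ‖y‖ := by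
  set κ := l ^ 2 - (2 * l - c) * δ
  have hκ : κ < l ^ 2 := by
    have : 0 < (2 * l - c) * δ := mul_pos (by linarith) hδ
    simp only [κ]
    linarith
  refine ⟨√κ, Real.sqrt_nonneg _, ?_, fun y hy => ?_⟩
  · rw [Real.sqrt_lt' hl]
    exact hκ
  have h1 := norm_sq_le_of_inner_le hT h0 hc y
  have h2 : ‖T y - l • y‖ ^ 2 ≤ κ * ‖y‖ ^ 2 := by
    rw [norm_sub_sq_real, inner_smul_right, norm_smul, mul_pow, Real.norm_eq_abs, sq_abs]
    have h3 : (2 * l - c) * (δ * ‖y‖ ^ 2) ≤ (2 * l - c) * ⟪T y, y⟫ :=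
      mul_le_mul_of_nonneg_left (hK y hy) (by linarith)
    simp only [κ]
    linarith
  rcases eq_or_ne y 0 with rfl | hy0
  · simp
  -- A negative `κ` is compatible with the estimate only for `y = 0`.
  have hκ0 : 0 ≤ κ := by
    by_contra! h
    have h4 : 0 < ‖y‖ ^ 2 := by positivity
    nlinarith [sq_nonneg ‖T y - l • y‖]
  refine le_of_sq_le_sq ?_ (by positivity)
  rw [mul_pow, Real.sq_sqrt hκ0]
  exact h2

variable {A : H →L[ℝ] H}

theorem neg_smul_symm (hA : ∀ x y, ⟪A x, y⟫ = ⟪x, A y⟫) (t : ℝ) (x y : H) :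
    ⟪(-(t • A)) x, y⟫ = ⟪x, (-(t • A)) y⟫ := by
  simp [inner_smul_left, inner_smul_right, hA]

theorem inner_neg_smul (t : ℝ) (x : H) : ⟪(-(t • A)) x, x⟫ = -(t * ⟪A x, x⟫) := by
  simp [inner_smul_left]

theorem one_add_smul_symm (hA : ∀ x y, ⟪A x, y⟫ = ⟪x, A y⟫) (t : ℝ) (x y : H) :
    ⟪(1 + t • A) x, y⟫ = ⟪x, (1 + t • A) y⟫ := by
  simp [inner_add_left, inner_add_right, inner_smul_left, inner_smul_right, hA]

variable [CompleteSpace H]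

theorem tendsto_one_add_smul_pow (hA : ∀ x y, ⟪A x, y⟫ = ⟪x, A y⟫) (hneg : ∀ x, ⟪A x, x⟫ ≤ 0)
    {m : ℝ} (hm : ∀ x, m * ‖x‖ ^ 2 ≤ ⟪A x, x⟫) (hm0 : m < 0) {dt : ℝ} (hdt : 0 < dt)
    (hdt' : dt < -2 / m) (w : H) :
    ∃ ψ ∈ A.ker, Tendsto (fun n : ℕ => ((1 + dt • A) ^ n) w) atTop (𝓝 ψ) := by
  rw [lt_div_iff_of_neg hm0] at hdt'
  -- The condition `c < 2` is exactly `Δt < -2 / m`.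
  obtain ⟨ψ, hψ, hlim⟩ := tendsto_one_sub_pow (T := -(dt • A)) (c := -(dt * m))
    (neg_smul_symm hA dt)
    (fun x => by rw [inner_neg_smul]; nlinarith [hneg x]) (by linarith) (by nlinarith)
    (fun x => by rw [inner_neg_smul]; nlinarith [hm x]) w
  rw [sub_neg_eq_add] at hlim
  refine ⟨ψ, ?_, hlim⟩
  have h1 : (-(dt • A)) ψ = 0 := hψ
  have h2 : A ψ = 0 := by simpa [hdt.ne'] using h1
  exact h2

theorem exists_contraction_off_ker (hA : ∀ x y, ⟪A x, y⟫ = ⟪x, A y⟫) (hneg : ∀ x, ⟪A x, x⟫ ≤ 0)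
    {m : ℝ} (hm : ∀ x, m * ‖x‖ ^ 2 ≤ ⟪A x, x⟫) (hm0 : m < 0) {dt : ℝ} (hdt : 0 < dt)
    (hdt' : dt < -2 / m) {t : ℝ} (ht : t < 0) (hgap : ∀ a ∈ spectrum ℝ A, a ≠ 0 → a ≤ t) :
    ∃ ρ, 0 ≤ ρ ∧ ρ < 1 ∧ ∀ y ∈ A.kerᗮ, ‖(1 + dt • A) y‖ ≤ ρ * ‖y‖ := by
  rw [lt_div_iff_of_neg hm0] at hdt'
  have hcoer : ∀ y ∈ A.kerᗮ, -t * ‖y‖ ^ 2 ≤ ⟪(-A) y, y⟫ := fun y hy => by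
    refine coercive_of_spectral_gap (R := -A) (fun x y => by simp [hA])
      (fun x => by simpa using hneg x) (neg_pos.2 ht) (fun a ha ha0 => ?_) ?_
    · rw [← spectrum.neg_eq, Set.mem_neg] at ha
      linarith [hgap _ ha (neg_ne_zero.2 ha0)]
    · have : (-A).ker = A.ker := by
        ext x
        simp
      rwa [this]
  obtain ⟨ρ, hρ0, hρ, h⟩ := exists_norm_sub_smul_le (T := -(dt • A)) (c := -(dt * m)) (l := 1)
    (δ := dt * -t) (K := A.kerᗮ) (neg_smul_symm hA dt)
    (fun x => by rw [inner_neg_smul]; nlinarith [hneg x])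
    (fun x => by rw [inner_neg_smul]; nlinarith [hm x]) (by linarith) one_pos
    (mul_pos hdt (neg_pos.2 ht)) (fun y hy => by
      rw [inner_neg_smul, mul_assoc, ← mul_neg]
      refine mul_le_mul_of_nonneg_left ?_ hdt.le
      simpa using hcoer y hy)
  refine ⟨ρ, hρ0, hρ, fun y hy => ?_⟩
  have h1 := h y hy
  have h2 : (1 + dt • A) y = -((-(dt • A)) y - (1 : ℝ) • y) := by
    simp only [_root_.add_apply, one_apply_eq_self, _root_.smul_apply, _root_.neg_apply]
    module
  rwa [h2, norm_neg]

/-- If the norm were at most `1`, then `A ≥ -2 / Δt` as a form, so the spectrum would lie above `-2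
/ Δt > m`. -/
theorem one_lt_norm_one_add_smul {m : ℝ} (hm : m ∈ spectrum ℝ A) (hm0 : m < 0) {dt : ℝ}
    (hdt : -2 / m < dt) : 1 < ‖1 + dt • A‖ := by
  have hdt0 : 0 < dt := (div_pos_of_neg_of_neg (by norm_num) hm0).trans hdt
  rw [div_lt_iff_of_neg hm0] at hdt
  by_contra! hle
  have h1 : ∀ x, -2 / dt * ‖x‖ ^ 2 ≤ ⟪A x, x⟫ := fun x => by
    have h2 := (abs_le.1 (inner_apply_le_opNorm (1 + dt • A) x)).1
    have h3 : ⟪(1 + dt • A) x, x⟫ = ‖x‖ ^ 2 + dt * ⟪A x, x⟫ := by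
      simp [inner_add_left, inner_smul_left]
    have h4 : ‖1 + dt • A‖ * ‖x‖ ^ 2 ≤ 1 * ‖x‖ ^ 2 := by gcongr
    rw [div_mul_eq_mul_div, div_le_iff₀ hdt0]
    linarith
  have h2 := le_of_mem_spectrum h1 hm
  rw [div_le_iff₀ hdt0] at h2
  linarith

theorem norm_one_add_smul_pow_two_pow (hA : ∀ x y, ⟪A x, y⟫ = ⟪x, A y⟫) (t : ℝ) (k : ℕ) :
    ‖(1 + t • A) ^ 2 ^ k‖ = ‖1 + t • A‖ ^ 2 ^ k := by
  have h : IsSelfAdjoint (1 + t • A) := by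
    rw [ContinuousLinearMap.isSelfAdjoint_iff_isSymmetric]
    exact one_add_smul_symm hA t
  exact IsSelfAdjoint.norm_pow_two_pow (x := 1 + t • A) h k

/-- `K` is the kernel of `R = A - m`, and the gap makes `R` coercive on `Kᗮ`. Writing `1 + Δt A = Δt
R - l` with `l = -(1 + Δt m)` shows `-l` on `K` and a smaller norm on `Kᗮ`. -/
theorem exists_dominant_eigenspace (hA : ∀ x y, ⟪A x, y⟫ = ⟪x, A y⟫) (hneg : ∀ x, ⟪A x, x⟫ ≤ 0)
    {m : ℝ} (hm : ∀ x, m * ‖x‖ ^ 2 ≤ ⟪A x, x⟫) (hmem : m ∈ spectrum ℝ A) (hm0 : m < 0)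
    {dt : ℝ} (hdt : -2 / m < dt) {t : ℝ} (ht : m < t)
    (hgap : ∀ a ∈ spectrum ℝ A, a ≠ m → t ≤ a) :
    ∃ (K : Submodule ℝ H) (l ρ : ℝ), IsClosed (K : Set H) ∧ K ≠ ⊥ ∧ 1 < l ∧ ρ < l ∧ 0 ≤ ρ ∧
      (∀ k ∈ K, (1 + dt • A) k = -(l • k)) ∧ ∀ y ∈ Kᗮ, ‖(1 + dt • A) y‖ ≤ ρ * ‖y‖ := by
  have hdt0 : 0 < dt := (div_pos_of_neg_of_neg (by norm_num) hm0).trans hdt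
  rw [div_lt_iff_of_neg hm0] at hdt
  set R : H →L[ℝ] H := A - algebraMap ℝ (H →L[ℝ] H) m
  have hRa : ∀ x, R x = A x - m • x := fun x => by simp [R, Algebra.algebraMap_eq_smul_one]
  have hR : ∀ x y, ⟪R x, y⟫ = ⟪x, R y⟫ := fun x y => by
    simp [hRa, inner_sub_left, inner_sub_right, inner_smul_left, inner_smul_right, hA]
  have hRi : ∀ x, ⟪R x, x⟫ = ⟪A x, x⟫ - m * ‖x‖ ^ 2 := fun x => by
    simp [hRa, inner_sub_left, inner_smul_left]
  have hR0 : ∀ x, 0 ≤ ⟪R x, x⟫ := fun x => by rw [hRi]; linarith [hm x]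
  have hcoer : ∀ y ∈ R.kerᗮ, (t - m) * ‖y‖ ^ 2 ≤ ⟪R y, y⟫ := fun y hy => by
    refine coercive_of_spectral_gap hR hR0 (sub_pos.2 ht) (fun a ha ha0 => ?_) hy
    have h1 : m + a ∈ spectrum ℝ A := by
      rw [spectrum.mem_iff] at ha ⊢
      convert ha using 2
      simp only [R, map_add]
      abel
    have h2 := hgap _ h1 (by simpa using ha0)
    linarith
  set l := -(1 + dt * m)
  have hl : 1 < l := by simp only [l]; linarith
  have hlin : ∀ y, (1 + dt • A) y = (dt • R) y - l • y := fun y => by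
    simp only [_root_.add_apply, one_apply_eq_self, _root_.smul_apply, hRa, l]
    module
  -- From `A ≤ 0` one has `Δt R ≤ -Δt m = 1 + l`, which is below `2 l` because `l > 1`.
  obtain ⟨ρ, hρ0, hρ, h⟩ := exists_norm_sub_smul_le (T := dt • R) (c := 1 + l) (l := l)
    (δ := dt * (t - m)) (K := R.kerᗮ)
    (fun x y => by simp [inner_smul_left, inner_smul_right, hR])
    (fun x => by simpa [inner_smul_left] using mul_nonneg hdt0.le (hR0 x))
    (fun x => by
      have h1 : ⟪(dt • R) x, x⟫ = dt * ⟪R x, x⟫ := by simp [inner_smul_left]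
      rw [h1, hRi]
      simp only [l]
      nlinarith [hneg x])
    (by linarith) (by linarith) (mul_pos hdt0 (sub_pos.2 ht))
    (fun y hy => by
      have h1 : ⟪(dt • R) y, y⟫ = dt * ⟪R y, y⟫ := by simp [inner_smul_left]
      rw [h1, mul_assoc]
      exact mul_le_mul_of_nonneg_left (hcoer y hy) hdt0.le)
  refine ⟨R.ker, l, ρ, R.isClosed_ker, fun hbot => ?_, hl, hρ, hρ0, fun k hk => ?_,
    fun y hy => ?_⟩
  -- With trivial kernel, `R` would be coercive on the whole space, hence invertible, so `m` would
  -- not be in the spectrum.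
  · rw [spectrum.mem_iff, IsUnit.sub_iff] at hmem
    refine hmem (isUnit_of_coercive (sub_pos.2 ht) fun x => hcoer x ?_)
    rw [hbot, Submodule.bot_orthogonal_eq_top]
    trivial
  · have h1 : R k = 0 := hk
    rw [hlin, _root_.smul_apply, h1, smul_zero, zero_sub]
  · rw [hlin]
    exact h y hy

end Iteration

/-! ### Passing between `X` and the energy space -/

section Transfer

variable {X H : Type*} [NormedAddCommGroup X] [NormedSpace ℝ X] [NormedAddCommGroup H]
  [NormedSpace ℝ H] (e : X ≃L[ℝ] H)

theorem iterate_conj (F : X → X) (n : ℕ) (x : X) :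
    (fun y => e (F (e.symm y)))^[n] (e x) = e (F^[n] x) := by
  have h : Function.Semiconj e F (fun y => e (F (e.symm y))) := fun x => by simp
  exact ((h.iterate_right n) x).symm

theorem conj_one_add_smul (A : X →L[ℝ] X) (t : ℝ) :
    e.conjContinuousAlgEquiv (1 + t • A) = 1 + t • e.conjContinuousAlgEquiv A := by
  ext y
  simp

theorem hasStrictFDerivAt_conj {F : X → X} {S : X →L[ℝ] X} {u : X}
    (hF : HasStrictFDerivAt F S u) :
    HasStrictFDerivAt (fun y => e (F (e.symm y))) (e.conjContinuousAlgEquiv S) (e u) := by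
  have h1 : HasStrictFDerivAt F S (e.symm (e u)) := by simpa using hF
  exact (e : X →L[ℝ] H).hasStrictFDerivAt.comp (e u)
    (h1.comp (e u) (e.symm : H →L[ℝ] X).hasStrictFDerivAt)

theorem exists_ball_quadratic_conj {F : X → X} {S : X →L[ℝ] X} {u : X} (hu : F u = u)
    (hF : (fun x => F x - F u - S (x - u)) =O[𝓝 u] fun x => ‖x - u‖ ^ 2) :
    ∃ C > 0, ∃ ρ > 0, ∀ y ∈ Metric.ball (e u) ρ,
      ‖e (F (e.symm y)) - e u - e.conjContinuousAlgEquiv S (y - e u)‖ ≤ C * ‖y - e u‖ ^ 2 := by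
  have hs : Tendsto e.symm (𝓝 (e u)) (𝓝 u) := by
    have := e.symm.continuous.tendsto (e u)
    rwa [e.symm_apply_apply] at this
  have h1 : (fun y => ‖e.symm y - u‖ ^ 2) =O[𝓝 (e u)] fun y => ‖y - e u‖ ^ 2 := by
    have h2 := (e.symm : H →L[ℝ] X).isBigO_comp (fun y : H => y - e u) (𝓝 (e u))
    have h3 := h2.norm_norm.pow 2
    simpa using h3
  have h4 := ((e : X →L[ℝ] H).isBigO_comp _ (𝓝 (e u))).trans ((hF.comp_tendsto hs).trans h1)
  obtain ⟨C, hC, hb⟩ := h4.exists_pos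
  obtain ⟨ρ, hρ, h⟩ := Metric.eventually_nhds_iff_ball.1 hb.bound
  refine ⟨C, hC, ρ, hρ, fun y hy => ?_⟩
  have h5 := h y hy
  rw [Real.norm_of_nonneg (by positivity)] at h5
  have h6 : e (F (e.symm y)) - e u - e.conjContinuousAlgEquiv S (y - e u) =
      e (F (e.symm y) - F u - S (e.symm y - u)) := by simp [hu]
  rw [h6]
  exact h5

theorem exists_escaping_orbit_of_conj {F : X → X} {u : X}
    (h : ∃ ε > 0, ∀ δ > 0, ∃ y₀, ‖y₀ - e u‖ < δ ∧
      ∃ n : ℕ, ε ≤ ‖(fun y => e (F (e.symm y)))^[n] y₀ - e u‖) :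
    ∃ ε > 0, ∀ δ > 0, ∃ x₀, ‖x₀ - u‖ < δ ∧ ∃ n : ℕ, ε ≤ ‖F^[n] x₀ - u‖ := by
  obtain ⟨ε, hε, h⟩ := h
  set a := ‖(e : X →L[ℝ] H)‖ + 1
  set b := ‖(e.symm : H →L[ℝ] X)‖ + 1
  have ha : 0 < a := by positivity
  have hb : 0 < b := by positivity
  refine ⟨ε / a, by positivity, fun δ hδ => ?_⟩
  obtain ⟨y₀, hy, n, hn⟩ := h (δ / b) (by positivity)
  refine ⟨e.symm y₀, ?_, n, ?_⟩
  · have h1 := (e.symm : H →L[ℝ] X).le_opNorm (y₀ - e u)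
    have h2 : (e.symm : H →L[ℝ] X) (y₀ - e u) = e.symm y₀ - u := by simp
    rw [h2] at h1
    rw [lt_div_iff₀ hb] at hy
    simp only [b] at hy
    nlinarith [norm_nonneg (y₀ - e u)]
  · have h1 := iterate_conj e F n (e.symm y₀)
    rw [e.apply_symm_apply] at h1
    rw [h1, ← map_sub] at hn
    rw [div_le_iff₀ ha]
    have h2 := (e : X →L[ℝ] H).le_opNorm (F^[n] (e.symm y₀) - u)
    have h3 : ‖e (F^[n] (e.symm y₀) - u)‖ ≤ ‖(e : X →L[ℝ] H)‖ * ‖F^[n] (e.symm y₀) - u‖ := h2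
    simp only [a]
    linarith [norm_nonneg (F^[n] (e.symm y₀) - u)]

theorem exists_interior_trapped_eq_empty_of_conj {F : X → X} {u : X}
    (h : ∃ ε > 0, interior {y | ∀ n : ℕ, ‖(fun y => e (F (e.symm y)))^[n] y - e u‖ < ε} = ∅) :
    ∃ ε > 0, interior {x | ∀ n : ℕ, ‖F^[n] x - u‖ < ε} = ∅ := by
  obtain ⟨ε, hε, h⟩ := h
  set a := ‖(e : X →L[ℝ] H)‖ + 1
  have ha : 0 < a := by positivity
  refine ⟨ε / a, by positivity, ?_⟩
  have hsub : {x | ∀ n : ℕ, ‖F^[n] x - u‖ < ε / a} ⊆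
      e ⁻¹' {y | ∀ n : ℕ, ‖(fun y => e (F (e.symm y)))^[n] y - e u‖ < ε} := by
    intro x hx n
    rw [iterate_conj, ← map_sub]
    have h1 : ‖F^[n] x - u‖ < ε / a := hx n
    rw [lt_div_iff₀ ha] at h1
    have h2 : ‖e (F^[n] x - u)‖ ≤ ‖(e : X →L[ℝ] H)‖ * ‖F^[n] x - u‖ :=
      (e : X →L[ℝ] H).le_opNorm _
    simp only [a] at h1
    linarith [norm_nonneg (F^[n] x - u)]
  have h1 := interior_mono hsub
  have h2 : interior (e ⁻¹' {y | ∀ n : ℕ, ‖(fun y => e (F (e.symm y)))^[n] y - e u‖ < ε}) = ∅ := by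
    have h3 := e.toHomeomorph.preimage_interior
      {y | ∀ n : ℕ, ‖(fun y => e (F (e.symm y)))^[n] y - e u‖ < ε}
    rw [h] at h3
    exact h3.symm
  exact Set.subset_empty_iff.1 (h2 ▸ h1)

end Transfer

/-- Otherwise the form vanishes identically, all `δQⱼ/δu` are zero, and so is `∂Q/∂μ`. For `r ≥ 1`
the zero matrix has determinant `0`. -/
theorem ConstrainedEquation.exists_op_LQC_neg {X : Type*} [NormedAddCommGroup X] [NormedSpace ℝ X]
    {r s : ℕ} (hr : 1 ≤ r) (E : ConstrainedEquation X r) (M : AccelerationOperator X) {h : ℝ}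
    (hh : 0 < h) {U : (Fin r → ℝ) × (Fin s → ℝ) → X} {μ₀ : Fin r → ℝ} {c₀ : Fin s → ℝ}
    (hU : E.IsSolutionFamily U μ₀ c₀) (hQ : ∀ j, DifferentiableAt ℝ (E.Q j) (U (μ₀, c₀)))
    (hG : (E.gram M (U (μ₀, c₀))).det ≠ 0) (hdet : (E.dQdmu U μ₀ c₀).det ≠ 0) :
    ∃ ψ, M.op (E.LQC M h μ₀ (U (μ₀, c₀)) ψ) ψ < 0 := by
  by_contra! hcon
  have : Nonempty (Fin r) := ⟨⟨0, hr⟩⟩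
  apply hdet
  have h0 : E.dQdmu U μ₀ c₀ = 0 := by
    ext i j
    rw [E.dQdmu_apply hU hQ]
    exact (E.eq_projB_of_op_LQC_self M hG hh
      (le_antisymm (E.op_LQC_self_nonpos M hG hh μ₀ _) (hcon _))).2 i
  rw [h0, Matrix.det_zero]

end SolitaryWave

/-! ### Assembly of the theorem -/

open SolitaryWave

theorem theorem6 {X : Type*} [NormedAddCommGroup X] [NormedSpace ℝ X] [CompleteSpace X]
    {r s : ℕ} (hr : 1 ≤ r)
    (E : SolitaryWave.ConstrainedEquation X r) (M : SolitaryWave.AccelerationOperator X)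
    (h : ℝ) (hh : 0 < h)
    -- the solution family `U(μ; c)` and the solitary wave `u = U(μ₀; c₀)`
    (U : (Fin r → ℝ) × (Fin s → ℝ) → X) (μ₀ : Fin r → ℝ) (c₀ : Fin s → ℝ)
    (u : X) (hu : u = U (μ₀, c₀))
    (hU : E.IsSolutionFamily U μ₀ c₀)
    (hC : ∀ j, E.Q j u = E.C j)
    -- smoothness of the data near `u`
    (hL00 : ContDiffAt ℝ 2 E.L00 u) (hB : ∀ j, ContDiffAt ℝ 2 (E.B j) u)
    (hQ : ∀ j, ContDiffAt ℝ 2 (E.Q j) u)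
    -- the kernel of `L₁` consists of the invariance modes only
    (hker : E.KernelIsInvarianceModes U μ₀ c₀)
    -- each `δQⱼ/δu` is orthogonal to the kernel of `L₁`
    (horth : ∀ j, ∀ ψ ∈ (E.L1 μ₀ u).ker, E.dQ j u ψ = 0)
    (hdet : (E.dQdmu U μ₀ c₀).det ≠ 0) :
    ∃ Λmin : ℝ, IsLeast (spectrum ℝ (E.LQC M h μ₀ u)) Λmin ∧ Λmin < 0 ∧
      -- the linearized error iteration converges to an invariance mode
      (∀ dt : ℝ, 0 < dt → dt < -2 / Λmin → ∀ w : X, ∃ ψ ∈ (E.L1 μ₀ u).ker,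
        Tendsto (fun n : ℕ => ((1 + dt • E.LQC M h μ₀ u) ^ n) w) atTop (𝓝 ψ)) ∧
      -- convergence of the method, when zero is not an accumulation point of the spectrum
      ((∃ Λmax < 0, ∀ Λ ∈ spectrum ℝ (E.LQC M h μ₀ u), Λ ≠ 0 → Λ ≤ Λmax) →
        ∀ dt : ℝ, 0 < dt → dt < -2 / Λmin → E.ConvergesNear M h dt U μ₀ c₀) ∧
      -- divergence of the method
      (∀ dt : ℝ, -2 / Λmin < dt → E.DivergesFrom M h dt u) ∧
      -- generic divergence, when `Λmin` is an isolated point of the spectrum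
      ((∃ Λ' > Λmin, ∀ Λ ∈ spectrum ℝ (E.LQC M h μ₀ u), Λ ≠ Λmin → Λ' ≤ Λ) →
        ∀ dt : ℝ, -2 / Λmin < dt → E.DivergesGenericallyFrom M h dt u) := by
  subst hu
  set u := U (μ₀, c₀) with hu
  have hLd : DifferentiableAt ℝ E.L00 u := hL00.differentiableAt two_ne_zero
  have hBd : ∀ j, DifferentiableAt ℝ (E.B j) u := fun j => (hB j).differentiableAt two_ne_zero
  have hQd : ∀ j, DifferentiableAt ℝ (E.Q j) u := fun j => (hQ j).differentiableAt two_ne_zero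
  have hG : (E.gram M u).det ≠ 0 :=
    E.gram_det_ne_zero M (E.linearIndependent_B hU hLd hBd hQd horth hdet)
  have h0 : E.L0 μ₀ u = 0 := hU.2.self_of_nhds
  have hfix : ∀ dt, E.step M h dt u = u := E.step_eq_self M hG h0 hC h
  set A := E.LQC M h μ₀ u
  set e : X ≃L[ℝ] EnergySpace M := EnergySpace.equiv M
  set T := e.conjContinuousAlgEquiv A
  have hTe : ∀ x, T (e x) = e (A x) := fun x => by simp [T]
  have hTin : ∀ x y, inner ℝ (T (e x)) (e y) = M.op (A x) y := fun x y => by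
    rw [hTe]
    exact EnergySpace.inner_equiv M _ _
  have hsymm : ∀ x y, inner ℝ (T x) y = inner ℝ x (T y) := fun x y => by
    obtain ⟨x, rfl⟩ := e.surjective x
    obtain ⟨y, rfl⟩ := e.surjective y
    rw [hTin, hTe, E.op_LQC_symm M hG]
    exact (EnergySpace.inner_equiv M _ _).symm
  have hneg : ∀ x, inner ℝ (T x) x ≤ 0 := fun x => by
    obtain ⟨x, rfl⟩ := e.surjective x
    rw [hTin]
    exact E.op_LQC_self_nonpos M hG hh μ₀ x
  have hspec : spectrum ℝ T = spectrum ℝ A :=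
    AlgEquiv.spectrum_eq e.conjContinuousAlgEquiv.toAlgEquiv A
  have hTker : ∀ x, e x ∈ T.ker ↔ x ∈ (E.L1 μ₀ u).ker := fun x => by
    rw [← E.ker_LQC M hU hLd hBd hQd horth hdet hh]
    change T (e x) = 0 ↔ A x = 0
    rw [hTe, map_eq_zero_iff e e.injective]
  have hconj : ∀ dt : ℝ, e.conjContinuousAlgEquiv (1 + dt • A) = 1 + dt • T :=
    conj_one_add_smul e A
  obtain ⟨ψ₀, hψ₀⟩ := E.exists_op_LQC_neg hr M hh hU hQd hG hdet
  -- A direction of strict negativity shows that the space is nonzero, so the spectrum has a least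
  -- element, and that this element is negative.
  have hnt : Nontrivial (EnergySpace M) := ⟨e ψ₀, 0, fun hψ => by
    rw [map_eq_zero_iff e e.injective] at hψ
    simp [hψ] at hψ₀⟩
  obtain ⟨m, hleast, hm⟩ := exists_isLeast_spectrum hsymm
  have hm0 : m < 0 := by
    by_contra! hm0
    have h1 := hm (e ψ₀)
    rw [hTin] at h1
    have h2 : 0 ≤ m * ‖e ψ₀‖ ^ 2 := by positivity
    linarith
  have hstrict : ∀ dt, HasStrictFDerivAt (fun y => e (E.step M h dt (e.symm y)))
      (1 + dt • T) (e u) := fun dt => by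
    rw [← hconj]
    exact hasStrictFDerivAt_conj e (E.hasStrictFDerivAt_step M hL00 hB hQ hG h0 hC h dt)
  refine ⟨m, hspec ▸ hleast, hm0, ?_, ?_, ?_, ?_⟩
  · intro dt hdt hdt' w
    obtain ⟨ψ, hψ, hlim⟩ := tendsto_one_add_smul_pow hsymm hneg hm hm0 hdt hdt' (e w)
    refine ⟨e.symm ψ, (hTker _).1 (by rwa [e.apply_symm_apply]), ?_⟩
    refine ((e.symm.continuous.tendsto ψ).comp hlim).congr fun n => ?_
    rw [Function.comp_apply, ← hconj, ← map_pow,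
      ContinuousLinearEquiv.conjContinuousAlgEquiv_apply_apply, e.symm_apply_apply,
      e.symm_apply_apply]
  · rintro ⟨t, ht, hgap⟩ dt hdt hdt'
    rw [← hspec] at hgap
    obtain ⟨ρ, hρ0, hρ, hcontr⟩ :=
      exists_contraction_off_ker hsymm hneg hm hm0 hdt hdt' ht hgap
    have : CompleteSpace T.ker := T.isClosed_ker.completeSpace_coe
    have hUc : ContinuousAt U (μ₀, c₀) := hU.1.continuousAt
    have key := tendsto_iterate_of_normally_contracting (hstrict dt) (by simp [hfix])
      (one_add_smul_symm hsymm dt) (K := T.ker) (fun k hk => by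
        have h1 : T k = 0 := hk
        simp [h1]) hρ0 hρ hcontr (U := fun p => e (U p)) (p₀ := (μ₀, c₀))
      (e.continuous.continuousAt.comp hUc) rfl
      (good := fun p => E.L0 p.1 (U p) = 0 ∧ ∀ j, E.Q j (U p) = E.C j) (fun N hN => by
        -- A family member is a fixed point only where its own Gram matrix is invertible, so the
        -- neighbourhood of parameters is shrunk accordingly.
        have hGN := hUc.eventually (E.eventually_gram_det_ne_zero M hB hG)
        filter_upwards [E.eventually_exists_solution_below e hU hC hQ hker horth hdet
          (K := T.ker) (fun k hk => (hTker _).1 (by rwa [e.apply_symm_apply]))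
          (inter_mem hN hGN)] with x ⟨p, hp, hgood, hperp⟩
        refine ⟨p, hp.1, hgood, ?_, hperp⟩
        rw [e.symm_apply_apply, E.step_eq_self M hp.2 hgood.1 hgood.2])
    intro ε hε
    have h1 := e.continuous.continuousAt.eventually (key _ (Metric.ball_mem_nhds (μ₀, c₀) hε))
    obtain ⟨δ, hδ, hball⟩ := Metric.eventually_nhds_iff_ball.1 h1
    refine ⟨δ, hδ, fun u₀ hu₀ => ?_⟩
    obtain ⟨p, hp, hgood, hlim⟩ := hball u₀ (mem_ball_iff_norm.2 hu₀)
    refine ⟨p, mem_ball_iff_norm.1 hp, hgood.1, hgood.2, ?_⟩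
    have h2 := (e.symm.continuous.tendsto _).comp hlim
    rw [e.symm_apply_apply] at h2
    refine h2.congr fun n => ?_
    rw [Function.comp_apply, iterate_conj, e.symm_apply_apply]
  · intro dt hdt
    obtain ⟨C, hC0, ρ, hρ, hquad⟩ := exists_ball_quadratic_conj e (hfix dt)
      (E.isBigO_step_sub M hL00 hB hQ hG h0 hC h dt)
    rw [hconj] at hquad
    exact exists_escaping_orbit_of_conj e (exists_escaping_orbit hC0 hρ hquad
      (one_lt_norm_one_add_smul hleast.1 hm0 hdt) (norm_one_add_smul_pow_two_pow hsymm dt))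
  · rintro ⟨t, ht, hgap⟩ dt hdt
    rw [← hspec] at hgap
    obtain ⟨K, l, ρ, hKc, hne, hl, hρ, hρ0, hK, hKperp⟩ :=
      exists_dominant_eigenspace hsymm hneg hm hleast.1 hm0 hdt ht hgap
    have : CompleteSpace K := hKc.completeSpace_coe
    exact exists_interior_trapped_eq_empty_of_conj e (exists_interior_trapped_eq_empty
      (hstrict dt) (one_add_smul_symm hsymm dt) hne hl hρ hρ0 hK hKperp)
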